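/- Let $n,m,p\ge 0$ be integers. Let $\mathrm{Sym}(n)$ be the space of real symmetric $n\times n$ matrices, and let $N$ be the set of triples $\Theta=(A,B,C)\in \mathrm{Sym}(n)\times\mathbf R^{n\times m}\times\mathbf R^{p\times n}$ such that $A$ is positive definite and the discrete-time system $x_{k+1}=Ax_k+Bu_k$, $y_k=Cx_k$ is controllable (any state can be steered to any state in finite time) and observable (any two distinct initial states are distinguished by the outputs for some input). $N$ is an open submanifold of the vector space $\mathrm{Sym}(n)\times\mathbf R^{n\times m}\times\mathbf R^{p\times n}$, with which its tangent spaces are identified. For $U\in O(n)$ let $\phi_U:N\to N$, $\phi_U(A,B,C)=(U^TAU,\,U^TB,\,CU)$; write $\Theta_1\sim\Theta_2$ if $\Theta_2=\phi_U(\Theta_1)$ for some $U\in O(n)$, let $N/O(n)$ be the set of equivalence classes with the quotient topology, and let $\pi:N\to N/O(n)$ be the projection. For $\Theta=(A,B,C)\in N$ put $$\langle(\xi_1,\eta_1,\zeta_1),(\xi_2,\eta_2,\zeta_2)\rangle_\Theta:=\mathrm{tr}(A^{-1}\xi_1A^{-1}\xi_2)+\mathrm{tr}(\eta_1^T\eta_2)+\mathrm{tr}(\zeta_1^T\zeta_2)$$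 on $T_\Theta N$. Then: 1. $\langle\cdot,\cdot\rangle$ is a smooth Riemannian metric on $N$, and every $\phi_U$, $U\in O(n)$, is a diffeomorphism of $N$ and an isometry: $\langle D\phi_U(\Theta)[v],D\phi_U(\Theta)[w]\rangle_{\phi_U(\Theta)}=\langle v,w\rangle_\Theta$ for all $\Theta\in N$ and $v,w\in T_\Theta N$. 2. $N/O(n)$ is Hausdorff and second countable, and it carries a smooth manifold structure of dimension $n+nm+pn$ for which $\pi$ is a smooth submersion. 3. Give $N/O(n)$ any such smooth structure. Let the vertical space $\mathcal V_\Theta\subset T_\Theta N$ be the tangent space at $\Theta$ of the fiber $\pi^{-1}(\pi(\Theta))$, that is, the set of velocities at $\Theta$ of smooth curves in the fiber, and let the horizontal space $\mathcal H_\Theta$ be its orthogonal complement with respect to $\langle\cdot,\cdot\rangle_\Theta$. A horizontal lift of $\xi\in T_{q}(N/O(n))$ at $\Theta\in\pi^{-1}(q)$ is a vector $\bar\xi_\Theta\in\mathcal H_\Theta$ with $D\pi(\Theta)[\bar\xi_\Theta]=\xi$. Then every $\xi\in T_q(N/O(n))$ has exactly one horizontal lift at every $\Theta\in\pi^{-1}(q)$;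 for all $q\in N/O(n)$, $\xi,\zeta\in T_q(N/O(n))$ and $\Theta_1,\Theta_2\in\pi^{-1}(q)$, $$\langle\bar\xi_{\Theta_1},\bar\zeta_{\Theta_1}\rangle_{\Theta_1}=\langle\bar\xi_{\Theta_2},\bar\zeta_{\Theta_2}\rangle_{\Theta_2};$$ and there is exactly one smooth Riemannian metric on $N/O(n)$ such that $\langle\xi,\zeta\rangle_{q}=\langle\bar\xi_\Theta,\bar\zeta_\Theta\rangle_\Theta$ for all $q\in N/O(n)$, $\xi,\zeta\in T_q(N/O(n))$ and $\Theta\in\pi^{-1}(q)$. -/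

import Mathlib

open scoped Manifold ContDiff Matrix Matrix.Norms.Elementwise Topology

noncomputable section

namespace SymSys

/-! ### Discrete-time linear systems `x (k+1) = A x k + B u k`, `y k = C x k` -/

/-- The state at time `k` of `x (k+1) = A x k + B u k` with initial state `x₀` and input `u`. -/
def state {n m : ℕ} (A : Matrix (Fin n) (Fin n) ℝ) (B : Matrix (Fin n) (Fin m) ℝ)
    (u : ℕ → Fin m → ℝ) (x₀ : Fin n → ℝ) : ℕ → Fin n → ℝ
  | 0 => x₀
  | k + 1 => A *ᵥ state A B u x₀ k + B *ᵥ u k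

/-- The system is controllable: any state can be steered to any state in finite time. -/
def IsControllable {n m : ℕ} (A : Matrix (Fin n) (Fin n) ℝ) (B : Matrix (Fin n) (Fin m) ℝ) :
    Prop :=
  ∀ x z : Fin n → ℝ, ∃ (k : ℕ) (u : ℕ → Fin m → ℝ), state A B u x k = z

/-- The system is observable: any two distinct initial states are told apart by the outputs
produced by some input. -/
def IsObservable {n m p : ℕ} (A : Matrix (Fin n) (Fin n) ℝ) (B : Matrix (Fin n) (Fin m) ℝ)
    (C : Matrix (Fin p) (Fin n) ℝ) : Prop :=
  ∀ x z : Fin n → ℝ, x ≠ z →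
    ∃ (k : ℕ) (u : ℕ → Fin m → ℝ), C *ᵥ state A B u x k ≠ C *ᵥ state A B u z k

/-! ### The parameter manifold -/

/-- The vector space `Sym(n)` of real symmetric matrices. -/
def SymMat (n : ℕ) : Submodule ℝ (Matrix (Fin n) (Fin n) ℝ) where
  carrier := {A | A.IsSymm}
  add_mem' := fun ha hb => ha.add hb
  zero_mem' := Matrix.isSymm_zero
  smul_mem' := fun c _ ha => ha.smul c

/-- The vector space `Sym(n) × ℝ^{n×m} × ℝ^{p×n}`. The norm is the sup norm; it only serves to fix
the topology and the smooth structure. -/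
def Ambient (n m p : ℕ) : Type :=
  SymMat n × Matrix (Fin n) (Fin m) ℝ × Matrix (Fin p) (Fin n) ℝ

instance (n m p : ℕ) : NormedAddCommGroup (Ambient n m p) :=
  inferInstanceAs (NormedAddCommGroup (SymMat n × Matrix (Fin n) (Fin m) ℝ × Matrix (Fin p) (Fin n) ℝ))

instance (n m p : ℕ) : NormedSpace ℝ (Ambient n m p) :=
  inferInstanceAs (NormedSpace ℝ (SymMat n × Matrix (Fin n) (Fin m) ℝ × Matrix (Fin p) (Fin n) ℝ))

/-- The component `A` of `(A, B, C)`. -/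
def Ambient.A {n m p : ℕ} (Θ : Ambient n m p) : Matrix (Fin n) (Fin n) ℝ := (Prod.fst Θ : SymMat n)

/-- The component `B` of `(A, B, C)`. -/
def Ambient.B {n m p : ℕ} (Θ : Ambient n m p) : Matrix (Fin n) (Fin m) ℝ := (Prod.snd Θ).1

/-- The component `C` of `(A, B, C)`. -/
def Ambient.C {n m p : ℕ} (Θ : Ambient n m p) : Matrix (Fin p) (Fin n) ℝ := (Prod.snd Θ).2

/-- The triple `(A, B, C)` with `A` symmetric. -/
def Ambient.mk {n m p : ℕ} (A : Matrix (Fin n) (Fin n) ℝ) (hA : A.IsSymm)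
    (B : Matrix (Fin n) (Fin m) ℝ) (C : Matrix (Fin p) (Fin n) ℝ) : Ambient n m p :=
  ((⟨A, hA⟩ : SymMat n), B, C)

theorem Ambient.ext {n m p : ℕ} {Θ Ξ : Ambient n m p} (hA : Θ.A = Ξ.A) (hB : Θ.B = Ξ.B)
    (hC : Θ.C = Ξ.C) : Θ = Ξ :=
  Prod.ext (Subtype.ext hA) (Prod.ext hB hC)

theorem Ambient.isSymm {n m p : ℕ} (Θ : Ambient n m p) : Θ.A.IsSymm := (Prod.fst Θ : SymMat n).2

theorem Ambient.continuous_A {n m p : ℕ} : Continuous (Ambient.A (n := n) (m := m) (p := p)) :=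
  continuous_subtype_val.comp
    (continuous_fst (X := SymMat n) (Y := Matrix (Fin n) (Fin m) ℝ × Matrix (Fin p) (Fin n) ℝ))

theorem Ambient.continuous_B {n m p : ℕ} : Continuous (Ambient.B (n := n) (m := m) (p := p)) :=
  continuous_fst.comp
    (continuous_snd (X := SymMat n) (Y := Matrix (Fin n) (Fin m) ℝ × Matrix (Fin p) (Fin n) ℝ))

theorem Ambient.continuous_C {n m p : ℕ} : Continuous (Ambient.C (n := n) (m := m) (p := p)) :=
  continuous_snd.comp
    (continuous_snd (X := SymMat n) (Y := Matrix (Fin n) (Fin m) ℝ × Matrix (Fin p) (Fin n) ℝ))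

/-- The triples `(A, B, C)` with `A` positive definite, controllable and observable. -/
def paramSet (n m p : ℕ) : Set (Ambient n m p) :=
  {Θ | Θ.A.PosDef ∧ IsControllable Θ.A Θ.B ∧ IsObservable Θ.A Θ.B Θ.C}

theorem state_add_smul {n m : ℕ} (A : Matrix (Fin n) (Fin n) ℝ) (B : Matrix (Fin n) (Fin m) ℝ)
    (u v : ℕ → Fin m → ℝ) (x y : Fin n → ℝ) (c : ℝ) (k : ℕ) :
    state A B (u + c • v) (x + c • y) k = state A B u x k + c • state A B v y k := by
  induction k with
  | zero => rfl
  | succ k ih =>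
    simp only [state, ih, Pi.add_apply, Pi.smul_apply, Matrix.mulVec_add, Matrix.mulVec_smul,
      smul_add]
    abel

theorem state_zero_zero {n m : ℕ} (A : Matrix (Fin n) (Fin n) ℝ) (B : Matrix (Fin n) (Fin m) ℝ)
    (k : ℕ) : state A B 0 0 k = 0 := by
  induction k with
  | zero => rfl
  | succ k ih => simp [state, ih]

theorem state_eq_add {n m : ℕ} (A : Matrix (Fin n) (Fin n) ℝ) (B : Matrix (Fin n) (Fin m) ℝ)
    (u : ℕ → Fin m → ℝ) (x : Fin n → ℝ) (k : ℕ) :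
    state A B u x k = state A B 0 x k + state A B u 0 k := by
  have := state_add_smul A B 0 u x 0 1 k
  simpa using this

theorem state_sum {n m : ℕ} (A : Matrix (Fin n) (Fin n) ℝ) (B : Matrix (Fin n) (Fin m) ℝ)
    {ι : Type} (s : Finset ι) (c : ι → ℝ) (u : ι → ℕ → Fin m → ℝ) (k : ℕ) :
    state A B (∑ i ∈ s, c i • u i) 0 k = ∑ i ∈ s, c i • state A B (u i) 0 k := by
  classical
  induction s using Finset.induction_on with
  | empty => simpa using state_zero_zero A B k
  | insert a s ha ih =>
    rw [Finset.sum_insert ha, Finset.sum_insert ha, add_comm, add_comm (c a • _), ← ih]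
    have := state_add_smul A B (∑ i ∈ s, c i • u i) (u a) 0 0 (c a) k
    simpa using this

/-- Preceding an input by `d` zero inputs delays the response from the zero state by `d`. -/
theorem state_delay {n m : ℕ} (A : Matrix (Fin n) (Fin n) ℝ) (B : Matrix (Fin n) (Fin m) ℝ)
    (u : ℕ → Fin m → ℝ) (d k : ℕ) :
    state A B (fun j => if j < d then 0 else u (j - d)) 0 (d + k) = state A B u 0 k := by
  induction k with
  | zero =>
    have h : ∀ j ≤ d, state A B (fun j => if j < d then 0 else u (j - d)) 0 j = 0 := by
      intro j
      induction j with
      | zero => intro _; rfl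
      | succ j ih =>
        intro hj
        have : j < d := hj
        simp [state, ih this.le, this]
    exact h d le_rfl
  | succ k ih =>
    rw [← add_assoc]
    simp [state, ih]

theorem state_conj {n m : ℕ} (A U V : Matrix (Fin n) (Fin n) ℝ) (B : Matrix (Fin n) (Fin m) ℝ)
    (hUV : U * V = 1) (u : ℕ → Fin m → ℝ) (x : Fin n → ℝ) (k : ℕ) :
    state (V * A * U) (V * B) u (V *ᵥ x) k = V *ᵥ state A B u x k := by
  induction k with
  | zero => rfl
  | succ k ih =>
    simp only [state, ih, Matrix.mulVec_add, Matrix.mulVec_mulVec]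
    rw [Matrix.mul_assoc (V * A) U V, hUV, Matrix.mul_one]

theorem continuous_state {n m : ℕ} {X : Type*} [TopologicalSpace X]
    {A : X → Matrix (Fin n) (Fin n) ℝ} {B : X → Matrix (Fin n) (Fin m) ℝ} {x : X → Fin n → ℝ}
    (hA : Continuous A) (hB : Continuous B) (u : ℕ → Fin m → ℝ) (hx : Continuous x) (k : ℕ) :
    Continuous fun t => state (A t) (B t) u (x t) k := by
  induction k with
  | zero => exact hx
  | succ k ih =>
    exact (hA.matrix_mulVec ih).add (hB.matrix_mulVec continuous_const)

theorem isOpen_posDef (n m p : ℕ) : IsOpen {Θ : Ambient n m p | Θ.A.PosDef} := by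
  rw [isOpen_iff_mem_nhds]
  intro A hA
  let W : Set (Ambient n m p × (Fin n → ℝ)) := {q | 0 < q.2 ⬝ᵥ (q.1.A *ᵥ q.2)}
  have hW : IsOpen W := by
    refine isOpen_lt continuous_const ?_
    exact continuous_snd.dotProduct
      ((Ambient.continuous_A.comp continuous_fst).matrix_mulVec continuous_snd)
  have hsub : ({A} : Set (Ambient n m p)) ×ˢ Metric.sphere (0 : Fin n → ℝ) 1 ⊆ W := by
    rintro ⟨A', x⟩ ⟨hA', hx⟩
    obtain rfl : A' = A := hA'
    have hx0 : x ≠ 0 := by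
      rintro rfl
      simp at hx
    simpa [W] using hA.dotProduct_mulVec_pos hx0
  obtain ⟨s, t, hs, -, hAs, ht, hst⟩ :=
    generalized_tube_lemma isCompact_singleton (isCompact_sphere _ _) hW hsub
  refine Filter.mem_of_superset (hs.mem_nhds (hAs rfl)) fun A' hA' => ?_
  refine Matrix.PosDef.of_dotProduct_mulVec_pos (by
    rw [Matrix.IsHermitian, Matrix.conjTranspose_eq_transpose_of_trivial]
    exact A'.isSymm) ?_
  intro x hx
  have hn : 0 < ‖x‖ := norm_pos_iff.mpr hx
  have hy : (‖x‖⁻¹ • x) ∈ Metric.sphere (0 : Fin n → ℝ) 1 := by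
    simp [norm_smul, hn.ne']
  have h : 0 < (‖x‖⁻¹ • x) ⬝ᵥ (A'.A *ᵥ (‖x‖⁻¹ • x)) :=
    hst (Set.mk_mem_prod hA' (ht hy))
  rw [Matrix.mulVec_smul, smul_dotProduct, dotProduct_smul, smul_eq_mul, smul_eq_mul] at h
  have h2 := pos_of_mul_pos_right h (inv_pos.mpr hn).le
  have h3 := pos_of_mul_pos_right h2 (inv_pos.mpr hn).le
  simpa using h3

theorem isOpen_controllable (n m p : ℕ) :
    IsOpen {Θ : Ambient n m p | IsControllable Θ.A Θ.B} := by
  rw [isOpen_iff_mem_nhds]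
  intro Θ hΘ
  choose k u hu using fun j : Fin n => hΘ 0 (Pi.single j 1)
  let K := Finset.univ.sup k
  let v : Fin n → ℕ → Fin m → ℝ := fun j i => if i < K - k j then 0 else u j (i - (K - k j))
  have hv : ∀ j, state Θ.A Θ.B (v j) 0 K = Pi.single j 1 := by
    intro j
    have hk : k j ≤ K := Finset.le_sup (Finset.mem_univ j)
    have := state_delay Θ.A Θ.B (u j) (K - k j) (k j)
    rw [Nat.sub_add_cancel hk] at this
    rw [← hu j, ← this]
  let W : Ambient n m p → Matrix (Fin n) (Fin n) ℝ := fun Ξ =>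
    Matrix.of fun i j => state Ξ.A Ξ.B (v j) 0 K i
  have hW : Continuous W := by
    refine continuous_matrix fun i j => ?_
    exact (continuous_apply i).comp (continuous_state Ambient.continuous_A
      Ambient.continuous_B (v j) continuous_const K)
  have hW1 : W Θ = 1 := by
    ext i j
    simp [W, hv, Matrix.one_apply, Pi.single_apply]
  have hO : IsOpen {Ξ | (W Ξ).det ≠ 0} := isOpen_ne_fun hW.matrix_det continuous_const
  refine Filter.mem_of_superset (hO.mem_nhds (by simp [hW1])) fun Ξ hΞ x z => ?_
  have hdet : IsUnit (W Ξ).det := isUnit_iff_ne_zero.mpr hΞ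
  let A : Matrix (Fin n) (Fin n) ℝ := Ξ.A
  let c : Fin n → ℝ := (W Ξ)⁻¹ *ᵥ (z - state A Ξ.B 0 x K)
  refine ⟨K, ∑ j, c j • v j, ?_⟩
  rw [state_eq_add, state_sum]
  have h : ∑ j, c j • state Ξ.A Ξ.B (v j) 0 K = W Ξ *ᵥ c := by
    ext i
    simp [W, Matrix.mulVec, dotProduct, Finset.sum_apply, mul_comm]
  rw [h, Matrix.mulVec_mulVec, Matrix.mul_nonsing_inv _ hdet, Matrix.one_mulVec]
  simp [A]

theorem isOpen_observable (n m p : ℕ) :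
    IsOpen {Θ : Ambient n m p |
      IsObservable Θ.A Θ.B Θ.C} := by
  have key : ∀ (Ξ : Ambient n m p) (x z : Fin n → ℝ) (k : ℕ) (u : ℕ → Fin m → ℝ),
      Ξ.C *ᵥ state Ξ.A Ξ.B u x k
        - Ξ.C *ᵥ state Ξ.A Ξ.B u z k
        = Ξ.C *ᵥ state Ξ.A Ξ.B 0 (x - z) k := by
    intro Ξ x z k u
    have := state_add_smul Ξ.A Ξ.B u u x z (-1) k
    rw [← Matrix.mulVec_sub]
    congr 1
    simpa [sub_eq_add_neg] using this.symm
  rw [isOpen_iff_mem_nhds]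
  intro Θ hΘ
  let W : Set (Ambient n m p × (Fin n → ℝ)) :=
    ⋃ k, {q | q.1.C *ᵥ state q.1.A q.1.B 0 q.2 k ≠ 0}
  have hW : IsOpen W := by
    refine isOpen_iUnion fun k => isOpen_ne_fun ?_ continuous_const
    refine Continuous.matrix_mulVec (Ambient.continuous_C.comp continuous_fst) ?_
    exact continuous_state (Ambient.continuous_A.comp continuous_fst)
      (Ambient.continuous_B.comp continuous_fst) 0 continuous_snd k
  have hsub : ({Θ} : Set (Ambient n m p)) ×ˢ Metric.sphere (0 : Fin n → ℝ) 1 ⊆ W := by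
    rintro ⟨Θ', x⟩ ⟨hΘ', hx⟩
    obtain rfl : Θ' = Θ := hΘ'
    have hx0 : x ≠ 0 := by
      rintro rfl
      simp at hx
    obtain ⟨k, u, h⟩ := hΘ x 0 hx0
    refine Set.mem_iUnion.mpr ⟨k, ?_⟩
    have hk := key Θ' x 0 k u
    rw [sub_zero] at hk
    change _ ≠ _
    rw [← hk]
    exact sub_ne_zero.mpr h
  obtain ⟨s, t, hs, -, hΘs, ht, hst⟩ :=
    generalized_tube_lemma isCompact_singleton (isCompact_sphere _ _) hW hsub
  refine Filter.mem_of_superset (hs.mem_nhds (hΘs rfl)) fun Ξ hΞ x z hxz => ?_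
  have hn : 0 < ‖x - z‖ := norm_pos_iff.mpr (sub_ne_zero.mpr hxz)
  have hy : (‖x - z‖⁻¹ • (x - z)) ∈ Metric.sphere (0 : Fin n → ℝ) 1 := by
    simp [norm_smul, hn.ne']
  obtain ⟨k, hk⟩ := Set.mem_iUnion.mp (hst (Set.mk_mem_prod hΞ (ht hy)))
  refine ⟨k, 0, fun heq => hk ?_⟩
  have h1 := key Ξ x z k 0
  rw [heq, sub_self] at h1
  have h2 := state_add_smul Ξ.A Ξ.B 0 0 0 (x - z) ‖x - z‖⁻¹ k
  simp only [smul_zero, add_zero, zero_add, state_zero_zero] at h2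
  change Ξ.C *ᵥ state Ξ.A Ξ.B 0 (‖x - z‖⁻¹ • (x - z)) k = 0
  rw [h2, Matrix.mulVec_smul, ← h1, smul_zero]

/-- The manifold `N`, an open submanifold of `Sym(n) × ℝ^{n×m} × ℝ^{p×n}`. -/
def N (n m p : ℕ) : TopologicalSpace.Opens (Ambient n m p) :=
  ⟨paramSet n m p, (isOpen_posDef n m p).inter
    ((isOpen_controllable n m p).inter (isOpen_observable n m p))⟩

/-! ### The action of the orthogonal group -/

/-- The linear map `(A, B, C) ↦ (Uᵀ A U, Uᵀ B, C U)`. -/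
def rot {n : ℕ} (m p : ℕ) (U : Matrix.orthogonalGroup (Fin n) ℝ) (Θ : Ambient n m p) :
    Ambient n m p :=
  Ambient.mk ((U : Matrix (Fin n) (Fin n) ℝ)ᵀ * Θ.A * (U : Matrix (Fin n) (Fin n) ℝ))
    (by
      rw [Matrix.IsSymm, Matrix.transpose_mul, Matrix.transpose_mul, Matrix.transpose_transpose,
        Θ.isSymm, Matrix.mul_assoc])
    ((U : Matrix (Fin n) (Fin n) ℝ)ᵀ * Θ.B) (Θ.C * (U : Matrix (Fin n) (Fin n) ℝ))

theorem rot_A {n m p : ℕ} (U : Matrix.orthogonalGroup (Fin n) ℝ) (Θ : Ambient n m p) :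
    (rot m p U Θ).A = (U : Matrix (Fin n) (Fin n) ℝ)ᵀ * Θ.A * (U : Matrix (Fin n) (Fin n) ℝ) := rfl

theorem rot_B {n m p : ℕ} (U : Matrix.orthogonalGroup (Fin n) ℝ) (Θ : Ambient n m p) :
    (rot m p U Θ).B = (U : Matrix (Fin n) (Fin n) ℝ)ᵀ * Θ.B := rfl

theorem rot_C {n m p : ℕ} (U : Matrix.orthogonalGroup (Fin n) ℝ) (Θ : Ambient n m p) :
    (rot m p U Θ).C = Θ.C * (U : Matrix (Fin n) (Fin n) ℝ) := rfl

theorem orth_mul_transpose {n : ℕ} (U : Matrix.orthogonalGroup (Fin n) ℝ) :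
    (U : Matrix (Fin n) (Fin n) ℝ) * (U : Matrix (Fin n) (Fin n) ℝ)ᵀ = 1 := by
  have := Matrix.mem_orthogonalGroup_iff (Fin n) ℝ |>.mp U.2
  simpa [Matrix.star_eq_conjTranspose, Matrix.conjTranspose_eq_transpose_of_trivial] using this

theorem orth_transpose_mul {n : ℕ} (U : Matrix.orthogonalGroup (Fin n) ℝ) :
    (U : Matrix (Fin n) (Fin n) ℝ)ᵀ * (U : Matrix (Fin n) (Fin n) ℝ) = 1 :=
  mul_eq_one_comm.mp (orth_mul_transpose U)

theorem rot_mem {n m p : ℕ} (U : Matrix.orthogonalGroup (Fin n) ℝ) {Θ : Ambient n m p}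
    (hΘ : Θ ∈ paramSet n m p) : rot m p U Θ ∈ paramSet n m p := by
  obtain ⟨h1, h2, h3⟩ := hΘ
  have hU := orth_mul_transpose U
  have hU' := orth_transpose_mul U
  have hinv : ∀ x : Fin n → ℝ,
      (U : Matrix (Fin n) (Fin n) ℝ)ᵀ *ᵥ ((U : Matrix (Fin n) (Fin n) ℝ) *ᵥ x) = x := by
    intro x
    rw [Matrix.mulVec_mulVec, hU', Matrix.one_mulVec]
  have hconj : ∀ (u : ℕ → Fin m → ℝ) (x : Fin n → ℝ) (k : ℕ),
      state (rot m p U Θ).A (rot m p U Θ).B u x k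
        = (U : Matrix (Fin n) (Fin n) ℝ)ᵀ *ᵥ state Θ.A Θ.B u
          ((U : Matrix (Fin n) (Fin n) ℝ) *ᵥ x) k := by
    intro u x k
    rw [← state_conj _ _ _ _ hU, hinv]
    rfl
  refine ⟨?_, ?_, ?_⟩
  · have hinj : Function.Injective (U : Matrix (Fin n) (Fin n) ℝ).mulVec :=
      Function.LeftInverse.injective (g := (U : Matrix (Fin n) (Fin n) ℝ)ᵀ.mulVec) hinv
    have := h1.conjTranspose_mul_mul_same hinj
    rw [Matrix.conjTranspose_eq_transpose_of_trivial] at this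
    exact this
  · intro x z
    obtain ⟨k, u, h⟩ := h2 ((U : Matrix (Fin n) (Fin n) ℝ) *ᵥ x)
      ((U : Matrix (Fin n) (Fin n) ℝ) *ᵥ z)
    exact ⟨k, u, by rw [hconj, h, hinv]⟩
  · intro x z hxz
    obtain ⟨k, u, h⟩ := h3 ((U : Matrix (Fin n) (Fin n) ℝ) *ᵥ x)
      ((U : Matrix (Fin n) (Fin n) ℝ) *ᵥ z) fun h => hxz (by rw [← hinv x, h, hinv z])
    refine ⟨k, u, ?_⟩
    rw [hconj, hconj]
    rwa [rot_C, Matrix.mulVec_mulVec, Matrix.mulVec_mulVec, Matrix.mul_assoc, hU, Matrix.mul_one]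

/-- `φ_U : N → N`, `φ_U (A, B, C) = (Uᵀ A U, Uᵀ B, C U)`. -/
def act {n m p : ℕ} (U : Matrix.orthogonalGroup (Fin n) ℝ) (Θ : N n m p) : N n m p :=
  ⟨rot m p U Θ, rot_mem U Θ.2⟩

theorem act_one {n m p : ℕ} (Θ : N n m p) : act 1 Θ = Θ := by
  apply Subtype.ext
  refine Ambient.ext ?_ ?_ ?_ <;> simp [act, rot_A, rot_B, rot_C]

theorem act_mul {n m p : ℕ} (U V : Matrix.orthogonalGroup (Fin n) ℝ) (Θ : N n m p) :
    act (U * V) Θ = act V (act U Θ) := by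
  apply Subtype.ext
  refine Ambient.ext ?_ ?_ ?_ <;> simp [act, rot_A, rot_B, rot_C, Matrix.mul_assoc]

/-- `Θ₁ ∼ Θ₂` iff `Θ₂ = U ∘ Θ₁` for some `U ∈ O(n)`. -/
instance orbitSetoid (n m p : ℕ) : Setoid (N n m p) where
  r Θ₁ Θ₂ := ∃ U : Matrix.orthogonalGroup (Fin n) ℝ, Θ₂ = act U Θ₁
  iseqv :=
    { refl := fun Θ => ⟨1, (act_one Θ).symm⟩
      symm := by
        rintro Θ₁ Θ₂ ⟨U, rfl⟩
        exact ⟨U⁻¹, by rw [← act_mul, mul_inv_cancel, act_one]⟩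
      trans := by
        rintro Θ₁ Θ₂ Θ₃ ⟨U, rfl⟩ ⟨V, rfl⟩
        exact ⟨U * V, (act_mul U V Θ₁).symm⟩ }

/-- The quotient `N/O(n)`, with the quotient topology. -/
abbrev OrbitSpace (n m p : ℕ) : Type := Quotient (orbitSetoid n m p)

/-- The canonical projection `π : N → N/O(n)`. -/
def proj (n m p : ℕ) (Θ : N n m p) : OrbitSpace n m p := Quotient.mk (orbitSetoid n m p) Θ

/-! ### The metric, vertical and horizontal spaces, horizontal lifts -/

/-- `⟨(ξ₁,η₁,ζ₁), (ξ₂,η₂,ζ₂)⟩_Θ = tr(A⁻¹ ξ₁ A⁻¹ ξ₂) + tr(η₁ᵀ η₂) + tr(ζ₁ᵀ ζ₂)`. As `N` is open in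
`Sym(n) × ℝ^{n×m} × ℝ^{p×n}`, its tangent spaces are this vector space. -/
def metric {n m p : ℕ} (Θ : N n m p) (v w : Ambient n m p) : ℝ :=
  (Θ.1.A⁻¹ * v.A * Θ.1.A⁻¹ * w.A).trace + (v.Bᵀ * w.B).trace + (v.Cᵀ * w.C).trace

/-- The vertical space `T_Θ π⁻¹([Θ])`: velocities at `Θ` of smooth curves inside the fiber. -/
def vertical {n m p : ℕ} (Θ : N n m p) : Set (Ambient n m p) :=
  {v | ∃ γ : ℝ → N n m p, γ 0 = Θ ∧ (∀ t, proj n m p (γ t) = proj n m p Θ) ∧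
    ContDiff ℝ ∞ (fun t => (γ t : Ambient n m p)) ∧
    deriv (fun t => (γ t : Ambient n m p)) 0 = v}

/-- The horizontal space: the orthogonal complement of the vertical space. -/
def horizontal {n m p : ℕ} (Θ : N n m p) : Set (Ambient n m p) :=
  {η | ∀ v ∈ vertical Θ, metric Θ v η = 0}

/-- The dimension `n + nm + pn` of `N/O(n)`, that is
`dim N - dim O(n) = n(n+1)/2 + nm + pn - n(n-1)/2`. -/
abbrev qdim (n m p : ℕ) : ℕ := n + n * m + p * n

/-- `η` is a horizontal lift at `Θ` of the tangent vector `ξ` of `N/O(n)`: it is horizontal and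
`Dπ(Θ)[η] = ξ`. The last equation is one between points of the tangent bundle, so it contains that
the base point of `ξ` is `π(Θ)`. -/
def IsHorizontalLift {n m p : ℕ} [ChartedSpace (EuclideanSpace ℝ (Fin (qdim n m p))) (OrbitSpace n m p)]
    (ξ : TangentBundle (𝓡 (qdim n m p)) (OrbitSpace n m p)) (Θ : N n m p) (η : Ambient n m p) : Prop :=
  η ∈ horizontal Θ ∧
    tangentMap 𝓘(ℝ, Ambient n m p) (𝓡 (qdim n m p)) (proj n m p) ⟨Θ, η⟩ = ξ

end SymSys

end

open SymSys

/-! The compact group O(n) acts freely on N, and controllability makes the group element visible.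
Fix Θ₀ and inputs that steer 0 to the n basis vectors at one common time K. The matrix S(Θ) of the
states these inputs reach (`reach`) is smooth in Θ, equals 1 at Θ₀ and satisfies S(φ_U Θ) = Uᵀ S(Θ)
(`reach_rot`). Hence an element of the orbit of Θ₀ determines U, and infinitesimally the map Ω ↦ (AΩ
− ΩA, −ΩB, CΩ) on skew matrices is injective. Its range is the vertical space (`vertical_eq_range`).

Near the orbit of Θ₀ write S = R X with X = (SᵀS)^{1/2} and R orthogonal. The point φ_R(Θ) depends
only on the orbit of Θ, and its matrix S is symmetric. So the points near Θ₀ with S symmetric form a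
slice, of dimension dim Sym(n) + nm + pn − dim Skew(n) = n + nm + pn (`exists_slice`). The slices
give the charts of N/O(n). Transition maps are smooth because coordinates and sections of slices
are, and π is a submersion because in a chart it is the coordinate map of a slice. The quotient is
Hausdorff because O(n) is compact and second countable because π is open.

The trace form is invariant because trace is cyclic, and positive because A⁻¹ = RᵀR turns
tr(A⁻¹ξA⁻¹ξ) into the squared Frobenius norm of RξRᵀ. A dimension count gives ker Dπ(Θ) = vertical
space, so η ↦ (Dπ η, ⟨vertical, η⟩) is an isomorphism (`exists_equiv_liftMap`); its inverse on (ξ,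
0) is the unique horizontal lift. As φ_U is an isometry with π ∘ φ_U = π, it maps lifts to lifts,
and their inner products descend. The quotient metric is smooth because the lift depends smoothly on
Θ and π has smooth local sections (`contMDiff_quotientForm`). -/

noncomputable section

namespace SymSys

/-! ### General tools: finite-dimensional forms, local inverses, submersions. -/

section

/-! ### Linear algebra in finite dimension -/

section LinearAlgebra

variable {E F K : Type*} [NormedAddCommGroup E] [NormedSpace ℝ E] [FiniteDimensional ℝ E]
  [NormedAddCommGroup F] [NormedSpace ℝ F] [FiniteDimensional ℝ F]
  [NormedAddCommGroup K] [NormedSpace ℝ K] [FiniteDimensional ℝ K]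

/-- An injective continuous linear map between spaces of the same finite dimension is an
isomorphism. -/
theorem exists_continuousLinearEquiv_of_injective (T : E →L[ℝ] F) (hT : Function.Injective T)
    (h : Module.finrank ℝ E = Module.finrank ℝ F) : ∃ e : E ≃L[ℝ] F, (e : E →L[ℝ] F) = T :=
  ⟨(LinearEquiv.ofInjectiveOfFinrankEq (T : E →ₗ[ℝ] F) hT h).toContinuousLinearEquiv, by
    ext x; rfl⟩

/-- A surjection `E → F` is the first component of an isomorphism `E ≃ F × K`, for every `K` of
the right dimension. -/
theorem exists_equiv_prod_of_surjective (D : E →L[ℝ] F) (hD : Function.Surjective D)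
    (h : Module.finrank ℝ E = Module.finrank ℝ F + Module.finrank ℝ K) :
    ∃ e : E ≃L[ℝ] F × K, ∀ x, (e x).1 = D x := by
  let D' : E →ₗ[ℝ] F := D
  have hr : Module.finrank ℝ (LinearMap.range D') = Module.finrank ℝ F := by
    rw [LinearMap.range_eq_top.mpr hD, finrank_top]
  have hk : Module.finrank ℝ (LinearMap.ker D') = Module.finrank ℝ K := by
    have := LinearMap.finrank_range_add_finrank_ker D'
    omega
  -- κ is a linear projection onto `ker D`. A vector killed by D lies in the kernel, where κ is the
  -- identity, so D and κ together are injective.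
  obtain ⟨κ, hκ⟩ := LinearMap.exists_leftInverse_of_injective (LinearMap.ker D').subtype
    (LinearMap.ker_eq_bot.mpr Subtype.val_injective)
  let ι : LinearMap.ker D' ≃ₗ[ℝ] K := LinearEquiv.ofFinrankEq _ _ hk
  let T : E →L[ℝ] F × K := D.prod (LinearMap.toContinuousLinearMap (ι.toLinearMap ∘ₗ κ))
  have hT : Function.Injective T := by
    rw [injective_iff_map_eq_zero]
    intro x hx
    have h1 : D x = 0 := congrArg Prod.fst hx
    have h2 : ι (κ x) = 0 := congrArg Prod.snd hx
    have h3 : κ x = 0 := by simpa using h2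
    have h4 := LinearMap.congr_fun hκ ⟨x, h1⟩
    have h5 : κ x = ⟨x, h1⟩ := h4
    rw [h3] at h5
    exact (congrArg Subtype.val h5).symm
  obtain ⟨e, he⟩ := exists_continuousLinearEquiv_of_injective T hT
    (by rw [Module.finrank_prod, h])
  exact ⟨e, fun x => congrArg Prod.fst (DFunLike.congr_fun he x)⟩

omit [FiniteDimensional ℝ K] in
/-- A subspace of codimension `dim F` is the kernel of a map to `F`. -/
theorem exists_ker_eq_range (V : K →L[ℝ] E) (hV : Function.Injective V)
    (h : Module.finrank ℝ E = Module.finrank ℝ F + Module.finrank ℝ K) :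
    ∃ P : E →L[ℝ] F, ∀ x, P x = 0 ↔ ∃ k, V k = x := by
  let R : Submodule ℝ E := LinearMap.range (V : K →ₗ[ℝ] E)
  have hR : Module.finrank ℝ R = Module.finrank ℝ K := LinearMap.finrank_range_of_inj hV
  have hq : Module.finrank ℝ (E ⧸ R) = Module.finrank ℝ F := by
    have := R.finrank_quotient_add_finrank
    omega
  let ι : (E ⧸ R) ≃ₗ[ℝ] F := LinearEquiv.ofFinrankEq _ _ hq
  refine ⟨LinearMap.toContinuousLinearMap (ι.toLinearMap ∘ₗ R.mkQ), fun x => ?_⟩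
  change ι (R.mkQ x) = 0 ↔ _
  rw [LinearEquiv.map_eq_zero_iff, ← LinearMap.mem_ker, Submodule.ker_mkQ]
  rfl

/-- In finite dimension the unit ball of a positive definite form is bounded. -/
theorem isVonNBounded_of_pos (b : E →L[ℝ] E →L[ℝ] ℝ) (hb : ∀ v, v ≠ 0 → 0 < b v v) :
    Bornology.IsVonNBounded ℝ {v | b v v < 1} := by
  apply NormedSpace.isVonNBounded_of_isBounded
  rcases subsingleton_or_nontrivial E with hE | hE
  · exact (Set.toFinite _).isBounded
  have hcont : Continuous fun v => b v v := b.continuous.clm_apply continuous_id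
  -- The minimum c > 0 of b on the unit sphere gives c‖v‖² ≤ b v v by homogeneity. The sphere is
  -- nonempty only in a nontrivial space, hence the case split.
  obtain ⟨v₀, hv₀, hmin⟩ := (isCompact_sphere (0 : E) 1).exists_isMinOn
    (NormedSpace.sphere_nonempty.mpr zero_le_one) hcont.continuousOn
  have hc : 0 < b v₀ v₀ := hb v₀ (by rintro rfl; simp at hv₀)
  rw [isBounded_iff_forall_norm_le]
  refine ⟨Real.sqrt (b v₀ v₀)⁻¹, fun v hv => ?_⟩
  rcases eq_or_ne v 0 with rfl | hv0
  · simp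
  have hn : 0 < ‖v‖ := norm_pos_iff.mpr hv0
  have hs : ‖v‖⁻¹ • v ∈ Metric.sphere (0 : E) 1 := by simp [norm_smul, hn.ne']
  have h1 : b v₀ v₀ ≤ b (‖v‖⁻¹ • v) (‖v‖⁻¹ • v) := hmin hs
  rw [map_smul, map_smul, _root_.smul_apply, smul_eq_mul, smul_eq_mul] at h1
  have hv' : b v v < 1 := hv
  have h2 : b v₀ v₀ * ‖v‖ ^ 2 ≤ b v v := by
    calc b v₀ v₀ * ‖v‖ ^ 2 ≤ (‖v‖⁻¹ * (‖v‖⁻¹ * b v v)) * ‖v‖ ^ 2 := by gcongr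
      _ = b v v := by field_simp
  apply Real.le_sqrt_of_sq_le
  rw [← one_div, le_div_iff₀ hc]
  linarith

end LinearAlgebra

/-! ### The inverse function theorem for smooth maps -/

/-- A smooth map with invertible derivative at a point restricts to a diffeomorphism near it. -/
theorem exists_smooth_openPartialHomeomorph {E F : Type*} [NormedAddCommGroup E] [NormedSpace ℝ E]
    [CompleteSpace E] [NormedAddCommGroup F] [NormedSpace ℝ F] {g : E → F} {s : Set E}
    (hs : IsOpen s) {x : E} (hx : x ∈ s) (hg : ContDiffOn ℝ ∞ g s) (e : E ≃L[ℝ] F)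
    (he : HasFDerivAt g (e : E →L[ℝ] F) x) :
    ∃ φ : OpenPartialHomeomorph E F, x ∈ φ.source ∧ φ.source ⊆ s ∧ ⇑φ = g ∧
      ContDiffOn ℝ ∞ φ φ.source ∧ ContDiffOn ℝ ∞ φ.symm φ.target := by
  have hgx : ContDiffAt ℝ ∞ g x := hg.contDiffAt (hs.mem_nhds hx)
  let φ₀ := hgx.toOpenPartialHomeomorph g he (by simp)
  have hφ₀ : ⇑φ₀ = g := rfl
  let R : Set (E →L[ℝ] F) := Set.range ContinuousLinearEquiv.toContinuousLinearMap
  have hR : IsOpen R := ContinuousLinearEquiv.isOpen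
  have hfd : ContinuousOn (fderiv ℝ g) s := hg.continuousOn_fderiv_of_isOpen hs (by simp)
  -- Restricting to the points where the derivative is invertible makes the inverse smooth on its
  -- whole domain, not only at the image of x.
  let t : Set E := s ∩ fderiv ℝ g ⁻¹' R
  have ht : IsOpen t := hfd.isOpen_inter_preimage hs hR
  have hxt : x ∈ t := ⟨hx, by rw [Set.mem_preimage, he.fderiv]; exact ⟨e, rfl⟩⟩
  let φ := φ₀.restrOpen t ht
  have hsrc : φ.source = φ₀.source ∩ t := rfl
  have hφ : ⇑φ = g := rfl
  refine ⟨φ, ⟨hgx.mem_toOpenPartialHomeomorph_source he (by simp), hxt⟩,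
    fun y hy => hy.2.1, hφ, ?_, ?_⟩
  · rw [hφ]
    exact hg.mono fun y hy => hy.2.1
  · intro y hy
    have hy' := φ.map_target hy
    obtain ⟨e', he'⟩ := hy'.2.2
    have hga : ContDiffAt ℝ ∞ g (φ.symm y) := hg.contDiffAt (hs.mem_nhds hy'.2.1)
    refine (φ.contDiffAt_symm hy (f₀' := e') ?_ (by rw [hφ]; exact hga)).contDiffWithinAt
    rw [he', hφ]
    exact (hga.differentiableAt (by simp)).hasFDerivAt

/-! ### Submersions -/

section Submersion

variable {E F K : Type*} [NormedAddCommGroup E] [NormedSpace ℝ E]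
  [NormedAddCommGroup F] [NormedSpace ℝ F] [NormedAddCommGroup K] [NormedSpace ℝ K]

/-- The chart of an open subset is its inclusion, so in charts the inclusion is the identity near x.
-/
theorem mfderiv_coe_opens (O : TopologicalSpace.Opens E) (x : O) :
    HasMFDerivAt 𝓘(ℝ, E) 𝓘(ℝ, E) (Subtype.val : O → E) x (ContinuousLinearMap.id ℝ E) := by
  refine ⟨continuous_subtype_val.continuousAt, ?_⟩
  have h : writtenInExtChartAt 𝓘(ℝ, E) 𝓘(ℝ, E) x (Subtype.val : O → E) =ᶠ[𝓝 (x : E)] id := by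
    filter_upwards [O.isOpen.mem_nhds x.2] with y hy
    have := (O.openPartialHomeomorphSubtypeCoe ⟨x⟩).right_inv (x := y) (by simpa using hy)
    exact this
  have h' : HasFDerivAt (writtenInExtChartAt 𝓘(ℝ, E) 𝓘(ℝ, E) x (Subtype.val : O → E))
      (ContinuousLinearMap.id ℝ E) (x : E) := (hasFDerivAt_id (x : E)).congr_of_eventuallyEq h
  exact h'.hasFDerivWithinAt

/-- With this, a map into O is smooth as soon as its composite with the inclusion is smooth. -/
theorem contMDiffOn_opens_symm (O : TopologicalSpace.Opens E) (hO : Nonempty O) :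
    ContMDiffOn 𝓘(ℝ, E) 𝓘(ℝ, E) ∞ (O.openPartialHomeomorphSubtypeCoe hO).symm O := by
  intro y hy
  have h := contMDiffAt_subtype_iff (n := ∞) (I := 𝓘(ℝ, E)) (I' := 𝓘(ℝ, E)) (U := O)
    (f := (O.openPartialHomeomorphSubtypeCoe hO).symm) (x := ⟨y, hy⟩)
  refine (h.mp ?_).contMDiffWithinAt
  refine contMDiffAt_id.congr_of_eventuallyEq (Filter.Eventually.of_forall fun z => ?_)
  exact (O.openPartialHomeomorphSubtypeCoe hO).left_inv (x := z) (by simp)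

/-- A map out of an open subset of a vector space is a submersion at `x` if its expression in a
chart of the target extends to a smooth map with surjective derivative. -/
theorem isSubmersionAtOfComplement_of_chart [CompleteSpace E] {Q : Type*} [TopologicalSpace Q]
    [ChartedSpace F Q] (O : TopologicalSpace.Opens E) {π : O → Q} (x : O) (hπ : ContinuousAt π x)
    (χ : OpenPartialHomeomorph Q F) (hχ : χ ∈ IsManifold.maximalAtlas 𝓘(ℝ, F) ∞ Q)
    (hx : π x ∈ χ.source) {U : Set E} (hU : IsOpen U) (hxU : (x : E) ∈ U) {g : E → F}
    (hg : ContDiffOn ℝ ∞ g U) (hgπ : ∀ y : O, (y : E) ∈ U → χ (π y) = g y)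
    (e : E ≃L[ℝ] F × K) (he : ∀ v, (e v).1 = fderiv ℝ g x v) :
    Manifold.IsSubmersionAtOfComplement K 𝓘(ℝ, E) 𝓘(ℝ, F) ∞ π x := by
  -- G replaces the first e-coordinate of y by g y. Its derivative at x is the identity, since e has
  -- first component Dg(x). So G is a chart near x, in which g becomes the projection y ↦ (e y).1.
  let G : E → E := fun y => e.symm (g y, (e y).2)
  have hG : ContDiffOn ℝ ∞ G (U ∩ O) :=
    e.symm.contDiff.comp_contDiffOn
      ((hg.mono Set.inter_subset_left).prodMk (contDiff_snd.comp e.contDiff).contDiffOn)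
  have hgd : HasFDerivAt g (fderiv ℝ g x) (x : E) :=
    ((hg.contDiffAt (hU.mem_nhds hxU)).differentiableAt (by simp)).hasFDerivAt
  have hGd : HasFDerivAt G ((ContinuousLinearEquiv.refl ℝ E : E ≃L[ℝ] E) : E →L[ℝ] E) (x : E) := by
    have h1 := e.symm.hasFDerivAt.comp (x : E) (hgd.prodMk
      (((ContinuousLinearMap.snd ℝ F K).comp (e : E →L[ℝ] F × K)).hasFDerivAt))
    refine h1.congr_fderiv ?_
    ext v
    change e.symm (fderiv ℝ g x v, (e v).2) = v
    rw [← he, Prod.mk.eta, e.symm_apply_apply]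
  obtain ⟨φ, hxφ, hφU, hφG, hφ1, hφ2⟩ := exists_smooth_openPartialHomeomorph
    (hU.inter O.isOpen) ⟨hxU, x.2⟩ hG _ hGd
  let c := O.openPartialHomeomorphSubtypeCoe ⟨x⟩
  let ψ : OpenPartialHomeomorph O E := c.trans φ
  have hψs : ∀ y, y ∈ ψ.source ↔ (y : E) ∈ φ.source := by
    intro y
    simp [ψ, c]
  have hψt : ψ.target ⊆ φ.target := by
    intro y hy
    exact hy.1
  have hψ : ψ ∈ IsManifold.maximalAtlas 𝓘(ℝ, E) ∞ O := by
    apply OpenPartialHomeomorph.mem_maximalAtlas_of_contMDiffOn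
    · refine hφ1.contMDiffOn.comp (contMDiff_subtype_val.contMDiffOn) ?_
      intro y hy
      exact (hψs y).mp hy
    · refine (contMDiffOn_opens_symm O ⟨x⟩).comp (hφ2.contMDiffOn.mono hψt) ?_
      intro y hy
      exact (hφU (φ.map_target (hψt hy))).2
  refine Manifold.IsSubmersionAtOfComplement.mk_of_continuousAt hπ e ψ χ ((hψs x).mpr hxφ) hx hψ hχ ?_
  intro y hy
  have hy1 : y ∈ ψ.target := by simpa using hy
  have hy2 : φ.symm y ∈ φ.source := φ.map_target (hψt hy1)
  have hyO : φ.symm y ∈ O := (hφU hy2).2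
  have hyv : (ψ.symm y : E) = φ.symm y := c.right_inv (x := φ.symm y) (by simpa [c] using hyO)
  change χ (π (ψ.symm y)) = (e y).1
  rw [hgπ _ (by rw [hyv]; exact (hφU hy2).1), hyv]
  have h3 : G (φ.symm y) = y := by rw [← hφG]; exact φ.right_inv (hψt hy1)
  conv_rhs => rw [← h3]
  simp [G]

/-- A submersion has smooth local sections. -/
theorem exists_local_section {H H' M N : Type*} [TopologicalSpace H] [TopologicalSpace H']
    {I : ModelWithCorners ℝ E H} {J : ModelWithCorners ℝ F H'} [I.Boundaryless] [J.Boundaryless]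
    [TopologicalSpace M] [ChartedSpace H M] [TopologicalSpace N] [ChartedSpace H' N]
    {f : M → N} {x : M} (h : Manifold.IsSubmersionAt I J ∞ f x) :
    ∃ σ : N → M, σ (f x) = x ∧ ContMDiffAt J I ∞ σ (f x) ∧ ∀ᶠ y in 𝓝 (f x), f (σ y) = y := by
  let ψ := h.domChart
  let χ := h.codChart
  have hx : x ∈ ψ.source := h.mem_domChart_source
  have hfx : f x ∈ χ.source := h.mem_codChart_source
  -- In charts the submersion is a projection; the section keeps the complementary coordinate of x
  -- fixed.
  let u : N → E := fun y => h.equiv.symm (χ.extend J y, (h.equiv (ψ.extend I x)).2)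
  have hw : (h.equiv (ψ.extend I x)).1 = χ.extend J (f x) := by
    have := h.writtenInCharts ((ψ.extend I).map_source (x := x) (by simpa using hx))
    simp only [Function.comp_apply] at this
    rw [← this, (ψ.extend I).left_inv (by simpa using hx)]
  have hux : u (f x) = ψ.extend I x := by
    simp only [u]
    rw [← hw, Prod.mk.eta, ContinuousLinearEquiv.symm_apply_apply]
  have hu : ContMDiffAt J 𝓘(ℝ, E) ∞ u (f x) := by
    have h1 : ContMDiffAt J 𝓘(ℝ, F) ∞ (χ.extend J) (f x) :=
      (χ.contMDiffOn_extend h.codChart_mem_maximalAtlas).contMDiffAt (χ.open_source.mem_nhds hfx)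
    have h2 : ContDiff ℝ ∞ fun z : F => h.equiv.symm (z, (h.equiv (ψ.extend I x)).2) :=
      h.equiv.symm.contDiff.comp (contDiff_id.prodMk contDiff_const)
    exact h2.contMDiff.contMDiffAt.comp (f x) h1
  have ht : (ψ.extend I).target ∈ 𝓝 (u (f x)) := by
    rw [hux]
    exact (ψ.isOpen_extend_target).mem_nhds ((ψ.extend I).map_source (by simpa using hx))
  have hσ : ContMDiffAt J I ∞ (fun y => (ψ.extend I).symm (u y)) (f x) := by
    refine ContMDiffAt.comp (f x) (g := (ψ.extend I).symm) ?_ hu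
    have := contMDiffOn_extend_symm h.domChart_mem_maximalAtlas
    rw [← OpenPartialHomeomorph.extend_target'] at this
    exact this.contMDiffAt ht
  refine ⟨fun y => (ψ.extend I).symm (u y), ?_, hσ, ?_⟩
  · simp only [hux]
    exact (ψ.extend I).left_inv (by simpa using hx)
  · filter_upwards [hu.continuousAt.preimage_mem_nhds ht, χ.open_source.mem_nhds hfx] with y hy hyχ
    have h1 := h.writtenInCharts hy
    have h2 : χ.extend J (f ((ψ.extend I).symm (u y))) = χ.extend J y := by
      simpa [u] using h1
    refine (χ.extend J).injOn ?_ (by simpa using hyχ) h2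
    have h3 := (ψ.extend I).map_target hy
    have h4 := h.source_subset_preimage_source (by simpa using h3)
    simpa using h4

/-- The derivative of a submersion is surjective. -/
theorem surjective_mfderiv {H H' M N : Type*} [TopologicalSpace H] [TopologicalSpace H']
    {I : ModelWithCorners ℝ E H} {J : ModelWithCorners ℝ F H'} [I.Boundaryless] [J.Boundaryless]
    [TopologicalSpace M] [ChartedSpace H M] [TopologicalSpace N] [ChartedSpace H' N]
    {f : M → N} {x : M} (h : Manifold.IsSubmersionAt I J ∞ f x) :
    Function.Surjective (mfderiv I J f x) := by
  obtain ⟨σ, hσx, hσ, hfσ⟩ := exists_local_section h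
  have h1 : HasMFDerivAt I J f (σ (f x)) (mfderiv I J f (σ (f x))) := by
    rw [hσx]
    exact (h.contMDiffAt.mdifferentiableAt (by simp)).hasMFDerivAt
  have h2 := h1.comp (f x) (hσ.mdifferentiableAt (by simp)).hasMFDerivAt
  -- f ∘ σ is the identity near f x, so Df ∘ Dσ = 1 and Df is onto.
  have h3 : HasMFDerivAt J J (f ∘ σ) (f x) (ContinuousLinearMap.id ℝ _) :=
    (hasMFDerivAt_id (f x)).congr_of_eventuallyEq hfσ
  have h4 := hasMFDerivAt_unique h2 h3
  intro v
  have h5 := DFunLike.congr_fun h4 v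
  rw [← hσx]
  exact ⟨_, h5⟩

end Submersion

end

/-! ### Matrix calculus, symmetric and skew matrices, dimension count. -/

section

/-! ### Calculus for matrix-valued maps -/

section MatrixCalculus

variable {E : Type*} [NormedAddCommGroup E] [NormedSpace ℝ E] {s : Set E} {x : E}

theorem contDiffOn_matrix {a b : ℕ} {f : E → Matrix (Fin a) (Fin b) ℝ}
    (h : ∀ i j, ContDiffOn ℝ ∞ (fun x => f x i j) s) : ContDiffOn ℝ ∞ f s :=
  contDiffOn_pi.mpr fun i => contDiffOn_pi.mpr fun j => h i j

theorem contDiffOn_entry {a b : ℕ} {f : E → Matrix (Fin a) (Fin b) ℝ} (h : ContDiffOn ℝ ∞ f s)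
    (i : Fin a) (j : Fin b) : ContDiffOn ℝ ∞ (fun x => f x i j) s :=
  contDiffOn_pi.mp (contDiffOn_pi.mp h i) j

theorem contDiffOn_matrix_mul {a b c : ℕ} {f : E → Matrix (Fin a) (Fin b) ℝ}
    {g : E → Matrix (Fin b) (Fin c) ℝ} (hf : ContDiffOn ℝ ∞ f s) (hg : ContDiffOn ℝ ∞ g s) :
    ContDiffOn ℝ ∞ (fun x => f x * g x) s :=
  contDiffOn_matrix fun i j => by
    simp only [Matrix.mul_apply]
    exact ContDiffOn.sum fun k _ => (contDiffOn_entry hf i k).mul (contDiffOn_entry hg k j)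

theorem contDiffOn_matrix_transpose {a b : ℕ} {f : E → Matrix (Fin a) (Fin b) ℝ}
    (hf : ContDiffOn ℝ ∞ f s) : ContDiffOn ℝ ∞ (fun x => (f x)ᵀ) s :=
  contDiffOn_matrix fun i j => contDiffOn_entry hf j i

theorem contDiffOn_matrix_trace {a : ℕ} {f : E → Matrix (Fin a) (Fin a) ℝ}
    (hf : ContDiffOn ℝ ∞ f s) : ContDiffOn ℝ ∞ (fun x => (f x).trace) s :=
  ContDiffOn.sum fun i _ => contDiffOn_entry hf i i

theorem contDiffOn_matrix_det {a : ℕ} {f : E → Matrix (Fin a) (Fin a) ℝ}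
    (hf : ContDiffOn ℝ ∞ f s) : ContDiffOn ℝ ∞ (fun x => (f x).det) s := by
  simp only [Matrix.det_apply]
  exact ContDiffOn.sum fun σ _ => (contDiffOn_prod fun i _ => contDiffOn_entry hf _ _).const_smul _

/-- Cramer's rule: the entries of the inverse are determinants divided by a nonvanishing
determinant. -/
theorem contDiffOn_matrix_inv {a : ℕ} {f : E → Matrix (Fin a) (Fin a) ℝ}
    (hf : ContDiffOn ℝ ∞ f s) (h : ∀ x ∈ s, (f x).det ≠ 0) :
    ContDiffOn ℝ ∞ (fun x => (f x)⁻¹) s := by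
  refine contDiffOn_matrix fun i j => ?_
  simp only [Matrix.inv_def, Matrix.smul_apply, smul_eq_mul, Ring.inverse_eq_inv',
    Matrix.adjugate_apply]
  refine ((contDiffOn_matrix_det hf).inv h).mul (contDiffOn_matrix_det ?_)
  refine contDiffOn_matrix fun k l => ?_
  simp only [Matrix.updateRow_apply]
  split_ifs
  · exact contDiffOn_const
  · exact contDiffOn_entry hf k l

theorem hasDerivAt_matrix_mul {a b c : ℕ} {f : ℝ → Matrix (Fin a) (Fin b) ℝ}
    {g : ℝ → Matrix (Fin b) (Fin c) ℝ} {f' : Matrix (Fin a) (Fin b) ℝ}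
    {g' : Matrix (Fin b) (Fin c) ℝ} {t : ℝ} (hf : HasDerivAt f f' t) (hg : HasDerivAt g g' t) :
    HasDerivAt (fun x => f x * g x) (f' * g t + f t * g') t := by
  refine hasDerivAt_pi.mpr fun i => hasDerivAt_pi.mpr fun j => ?_
  have h : HasDerivAt (fun x => ∑ k, f x i k * g x k j)
      (∑ k, (f' i k * g t k j + f t i k * g' k j)) t :=
    HasDerivAt.fun_sum fun k _ => (hasDerivAt_pi.mp (hasDerivAt_pi.mp hf i) k).mul
      (hasDerivAt_pi.mp (hasDerivAt_pi.mp hg k) j)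
  simp only [Matrix.mul_apply, Matrix.add_apply, ← Finset.sum_add_distrib]
  exact h

theorem hasDerivAt_matrix_transpose {a b : ℕ} {f : ℝ → Matrix (Fin a) (Fin b) ℝ}
    {f' : Matrix (Fin a) (Fin b) ℝ} {t : ℝ} (hf : HasDerivAt f f' t) :
    HasDerivAt (fun x => (f x)ᵀ) f'ᵀ t :=
  hasDerivAt_pi.mpr fun i => hasDerivAt_pi.mpr fun j =>
    hasDerivAt_pi.mp (hasDerivAt_pi.mp hf j) i

end MatrixCalculus

/-! ### Symmetric and skew-symmetric matrices -/

/-- The real skew-symmetric matrices, as a subspace. -/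
def skewSubmodule (n : ℕ) : Submodule ℝ (Matrix (Fin n) (Fin n) ℝ) where
  carrier := {Ω | Ωᵀ = -Ω}
  add_mem' := fun {a b} ha hb => by
    have ha : aᵀ = -a := ha
    have hb : bᵀ = -b := hb
    change (a + b)ᵀ = -(a + b)
    rw [Matrix.transpose_add, ha, hb, neg_add]
  zero_mem' := by simp
  smul_mem' := fun c a ha => by
    have ha : aᵀ = -a := ha
    change (c • a)ᵀ = -(c • a)
    rw [Matrix.transpose_smul, ha, smul_neg]

/-- The normed vector space of real skew-symmetric matrices. -/
def SkewMat (n : ℕ) : Type := skewSubmodule n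

instance (n : ℕ) : NormedAddCommGroup (SkewMat n) :=
  inferInstanceAs (NormedAddCommGroup (skewSubmodule n))

instance (n : ℕ) : NormedSpace ℝ (SkewMat n) := inferInstanceAs (NormedSpace ℝ (skewSubmodule n))

instance (n : ℕ) : FiniteDimensional ℝ (SkewMat n) :=
  inferInstanceAs (FiniteDimensional ℝ (skewSubmodule n))

/-- The matrix underlying an element of `SkewMat n`. -/
def SkewMat.mat {n : ℕ} (Ω : SkewMat n) : Matrix (Fin n) (Fin n) ℝ := Subtype.val Ω

/-- A skew-symmetric matrix as an element of `SkewMat n`. -/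
def SkewMat.mk {n : ℕ} (X : Matrix (Fin n) (Fin n) ℝ) (hX : Xᵀ = -X) : SkewMat n :=
  (⟨X, hX⟩ : skewSubmodule n)

instance (n : ℕ) : CoeOut (SkewMat n) (Matrix (Fin n) (Fin n) ℝ) := ⟨SkewMat.mat⟩

theorem SkewMat.ext {n : ℕ} {Ω Ω' : SkewMat n} (h : Ω.mat = Ω'.mat) : Ω = Ω' := Subtype.ext h

theorem SkewMat.mat_smul {n : ℕ} (c : ℝ) (Ω : SkewMat n) : (c • Ω).mat = c • Ω.mat := rfl

theorem SkewMat.mat_neg {n : ℕ} (Ω : SkewMat n) : (-Ω).mat = -Ω.mat := rfl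

theorem SkewMat.mat_zero {n : ℕ} : (0 : SkewMat n).mat = 0 := rfl

theorem skewMat_transpose {n : ℕ} (Ω : SkewMat n) : Ω.matᵀ = -Ω.mat := Subtype.property Ω

/-- The symmetric part of a matrix. -/
def symPart (n : ℕ) : Matrix (Fin n) (Fin n) ℝ →L[ℝ] SymMat n :=
  LinearMap.toContinuousLinearMap
    { toFun := fun M => ⟨(1 / 2 : ℝ) • (M + Mᵀ), by
        change ((1 / 2 : ℝ) • (M + Mᵀ))ᵀ = _
        simp [add_comm]⟩
      map_add' := fun M M' => Subtype.ext (by simp; abel)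
      map_smul' := fun c M => Subtype.ext (by simp [smul_comm c]) }

/-- The skew-symmetric part of a matrix. -/
def skewPart (n : ℕ) : Matrix (Fin n) (Fin n) ℝ →L[ℝ] SkewMat n :=
  LinearMap.toContinuousLinearMap
    { toFun := fun M => SkewMat.mk ((1 / 2 : ℝ) • (M - Mᵀ)) (by simp [← smul_neg])
      map_add' := fun M M' => SkewMat.ext (by
        change (1 / 2 : ℝ) • ((M + M') - (M + M')ᵀ)
          = (1 / 2 : ℝ) • (M - Mᵀ) + (1 / 2 : ℝ) • (M' - M'ᵀ)
        rw [Matrix.transpose_add, ← smul_add]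
        abel_nf)
      map_smul' := fun c M => SkewMat.ext (by
        change (1 / 2 : ℝ) • (c • M - (c • M)ᵀ) = c • ((1 / 2 : ℝ) • (M - Mᵀ))
        rw [Matrix.transpose_smul, ← smul_sub, smul_comm]) }

theorem coe_symPart {n : ℕ} (M : Matrix (Fin n) (Fin n) ℝ) :
    (symPart n M : Matrix (Fin n) (Fin n) ℝ) = (1 / 2 : ℝ) • (M + Mᵀ) := rfl

theorem coe_skewPart {n : ℕ} (M : Matrix (Fin n) (Fin n) ℝ) :
    (skewPart n M).mat = (1 / 2 : ℝ) • (M - Mᵀ) := rfl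

theorem symPart_coe {n : ℕ} (X : SymMat n) : symPart n (X : Matrix (Fin n) (Fin n) ℝ) = X := by
  have h : (X : Matrix (Fin n) (Fin n) ℝ)ᵀ = X := X.2
  refine Subtype.ext ?_
  rw [coe_symPart, h, ← two_smul ℝ, smul_smul]
  norm_num

theorem skewPart_coe {n : ℕ} (X : SkewMat n) : skewPart n X.mat = X := by
  refine SkewMat.ext ?_
  rw [coe_skewPart, skewMat_transpose, sub_neg_eq_add, ← two_smul ℝ, smul_smul]
  norm_num

theorem skewPart_eq_zero_iff {n : ℕ} (M : Matrix (Fin n) (Fin n) ℝ) :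
    skewPart n M = 0 ↔ Mᵀ = M := by
  constructor
  · intro h
    have h1 : (1 / 2 : ℝ) • (M - Mᵀ) = 0 := by rw [← coe_skewPart, h, SkewMat.mat_zero]
    have h2 : M - Mᵀ = 0 := by simpa using h1
    exact (sub_eq_zero.mp h2).symm
  · intro h
    refine SkewMat.ext ?_
    rw [coe_skewPart, h, sub_self, smul_zero, SkewMat.mat_zero]

/-- The symmetric matrices are the sum of the skew-symmetric ones and the diagonal, via the strictly
lower triangular part. -/
theorem finrank_symMat (n : ℕ) :
    Module.finrank ℝ (SymMat n) = Module.finrank ℝ (SkewMat n) + n := by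
  let T : SymMat n →ₗ[ℝ] skewSubmodule n × (Fin n → ℝ) :=
    { toFun := fun X => (⟨Matrix.of fun i j => if i < j then X.1 i j else
          if j < i then -X.1 i j else 0, by
          change Matrix.transpose _ = -_
          ext i j
          have h : X.1 j i = X.1 i j := congrFun (congrFun X.2 i) j
          simp only [Matrix.transpose_apply, Matrix.of_apply, Matrix.neg_apply, h]
          rcases lt_trichotomy i j with hij | rfl | hij
          · simp [hij, hij.not_gt]
          · simp
          · simp [hij, hij.not_gt]⟩, fun i => X.1 i i)
      map_add' := fun X Y => by
        refine Prod.ext (Subtype.ext ?_) rfl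
        ext i j
        simp only [Submodule.coe_add, Matrix.add_apply, Matrix.of_apply, Prod.mk_add_mk]
        split_ifs <;> ring
      map_smul' := fun c X => by
        refine Prod.ext (Subtype.ext ?_) rfl
        ext i j
        simp only [Submodule.coe_smul, Matrix.smul_apply, Matrix.of_apply, smul_eq_mul,
          RingHom.id_apply, Prod.smul_mk]
        split_ifs <;> ring }
  have hT : Function.Bijective T := by
    constructor
    · rw [injective_iff_map_eq_zero]
      intro X hX
      have h1 : (T X).1.1 = 0 := by rw [hX]; rfl
      have h2 : (T X).2 = 0 := by rw [hX]; rfl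
      refine Subtype.ext ?_
      ext i j
      have h3 := congrFun (congrFun h1 i) j
      simp only [T, LinearMap.coe_mk, AddHom.coe_mk, Matrix.of_apply, Matrix.zero_apply] at h3
      rcases lt_trichotomy i j with hij | rfl | hij
      · simpa [hij] using h3
      · exact congrFun h2 i
      · simpa [hij, hij.not_gt] using h3
    · rintro ⟨Ω, d⟩
      have hΩ : ∀ i j, Ω.1 j i = -Ω.1 i j := fun i j => congrFun (congrFun Ω.2 i) j
      refine ⟨⟨Matrix.of fun i j => if i < j then Ω.1 i j else if j < i then -Ω.1 i j else d i, ?_⟩,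
        ?_⟩
      · change Matrix.transpose _ = _
        ext i j
        rcases lt_trichotomy i j with hij | rfl | hij
        · simp [hij, hij.not_gt, hΩ i j]
        · simp
        · simp [hij, hij.not_gt, hΩ i j]
      · refine Prod.ext (Subtype.ext ?_) ?_
        · ext i j
          simp only [T, LinearMap.coe_mk, AddHom.coe_mk, Matrix.of_apply]
          rcases lt_trichotomy i j with hij | rfl | hij
          · simp [hij]
          · have := hΩ i i
            simp
            linarith
          · simp [hij, hij.not_gt]
        · ext i
          simp [T]
  rw [(LinearEquiv.ofBijective T hT).finrank_eq, Module.finrank_prod, Module.finrank_fin_fun]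
  rfl

/-! ### The ambient vector space -/

section Ambient

variable {n m p : ℕ}

instance : FiniteDimensional ℝ (Ambient n m p) :=
  inferInstanceAs (FiniteDimensional ℝ
    (SymMat n × Matrix (Fin n) (Fin m) ℝ × Matrix (Fin p) (Fin n) ℝ))

/-- Comparing dim Sym(n) with dim Skew(n) makes the explicit values n(n ± 1)/2 unnecessary: only the
difference n enters. -/
theorem finrank_ambient (n m p : ℕ) :
    Module.finrank ℝ (Ambient n m p) = qdim n m p + Module.finrank ℝ (SkewMat n) := by
  have h : Module.finrank ℝ (Ambient n m p) = Module.finrank ℝ (SymMat n) +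
      (Module.finrank ℝ (Matrix (Fin n) (Fin m) ℝ) + Module.finrank ℝ (Matrix (Fin p) (Fin n) ℝ)) :=
    (Module.finrank_prod (R := ℝ) (M := SymMat n)
      (M' := Matrix (Fin n) (Fin m) ℝ × Matrix (Fin p) (Fin n) ℝ)).trans
        (by rw [Module.finrank_prod])
  rw [h, finrank_symMat, Module.finrank_matrix, Module.finrank_matrix]
  simp only [Fintype.card_fin, Module.finrank_self, mul_one, qdim]
  ring

/-- The components `A`, `B`, `C` as a linear map. -/
def components (n m p : ℕ) : Ambient n m p →L[ℝ]
    Matrix (Fin n) (Fin n) ℝ × Matrix (Fin n) (Fin m) ℝ × Matrix (Fin p) (Fin n) ℝ :=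
  LinearMap.toContinuousLinearMap
    { toFun := fun Θ => (Θ.A, Θ.B, Θ.C)
      map_add' := fun _ _ => rfl
      map_smul' := fun _ _ => rfl }

/-- The triple with components `(M + Mᵀ) / 2`, `B` and `C`. -/
def assemble (n m p : ℕ) :
    Matrix (Fin n) (Fin n) ℝ × Matrix (Fin n) (Fin m) ℝ × Matrix (Fin p) (Fin n) ℝ →L[ℝ]
      Ambient n m p :=
  ((symPart n).comp (ContinuousLinearMap.fst ℝ _ _)).prod (ContinuousLinearMap.snd ℝ _ _)

theorem assemble_components (Θ : Ambient n m p) : assemble n m p (components n m p Θ) = Θ :=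
  Prod.ext (symPart_coe Θ.1) rfl

theorem Ambient.add_A (Θ Ξ : Ambient n m p) : (Θ + Ξ).A = Θ.A + Ξ.A := rfl
theorem Ambient.add_B (Θ Ξ : Ambient n m p) : (Θ + Ξ).B = Θ.B + Ξ.B := rfl
theorem Ambient.add_C (Θ Ξ : Ambient n m p) : (Θ + Ξ).C = Θ.C + Ξ.C := rfl
theorem Ambient.smul_A (c : ℝ) (Θ : Ambient n m p) : (c • Θ).A = c • Θ.A := rfl
theorem Ambient.smul_B (c : ℝ) (Θ : Ambient n m p) : (c • Θ).B = c • Θ.B := rfl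
theorem Ambient.smul_C (c : ℝ) (Θ : Ambient n m p) : (c • Θ).C = c • Θ.C := rfl

theorem contDiff_A : ContDiff ℝ ∞ (Ambient.A (n := n) (m := m) (p := p)) :=
  contDiff_fst.comp (components n m p).contDiff

theorem contDiff_B : ContDiff ℝ ∞ (Ambient.B (n := n) (m := m) (p := p)) :=
  ((ContinuousLinearMap.fst ℝ _ _).comp
    ((ContinuousLinearMap.snd ℝ _ _).comp (components n m p))).contDiff

theorem contDiff_C : ContDiff ℝ ∞ (Ambient.C (n := n) (m := m) (p := p)) :=
  ((ContinuousLinearMap.snd ℝ _ _).comp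
    ((ContinuousLinearMap.snd ℝ _ _).comp (components n m p))).contDiff

variable {E : Type*} [NormedAddCommGroup E] [NormedSpace ℝ E]

/-- `assemble` is linear and recovers a triple from its components, so calculus in the ambient space
may be done component by component. -/
theorem contDiffOn_ambient {f : E → Ambient n m p} {s : Set E}
    (hA : ContDiffOn ℝ ∞ (fun x => (f x).A) s) (hB : ContDiffOn ℝ ∞ (fun x => (f x).B) s)
    (hC : ContDiffOn ℝ ∞ (fun x => (f x).C) s) : ContDiffOn ℝ ∞ f s := by
  have h := (assemble n m p).contDiff.comp_contDiffOn (hA.prodMk (hB.prodMk hC))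
  exact h.congr fun x _ => (assemble_components (f x)).symm

theorem hasDerivAt_ambient {f : ℝ → Ambient n m p} {f' : Ambient n m p} {t : ℝ}
    (hA : HasDerivAt (fun x => (f x).A) f'.A t) (hB : HasDerivAt (fun x => (f x).B) f'.B t)
    (hC : HasDerivAt (fun x => (f x).C) f'.C t) : HasDerivAt f f' t := by
  have h := (assemble n m p).hasFDerivAt.comp_hasDerivAt t (hA.prodMk (hB.prodMk hC))
  have e : (assemble n m p) ∘ (fun x => ((f x).A, (f x).B, (f x).C)) = f :=
    funext fun x => assemble_components (f x)
  rw [e] at h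
  exact (assemble_components f') ▸ h

end Ambient

end

/-! ### Reached states, the infinitesimal action and the vertical space. -/

section

variable {n m p : ℕ}

/-! ### The matrix of states reached from zero -/

/-- The matrix whose `j`-th column is the state reached from `0` at time `K` with input `v j`. -/
def reach (K : ℕ) (v : Fin n → ℕ → Fin m → ℝ) (Θ : Ambient n m p) : Matrix (Fin n) (Fin n) ℝ :=
  Matrix.of fun i j => state Θ.A Θ.B (v j) 0 K i

/-- The inputs that steer 0 to the basis vectors may need different times. Zero inputs put in front
delay them all to the maximal time K. -/
theorem exists_reach_eq_one {Θ : Ambient n m p} (hΘ : IsControllable Θ.A Θ.B) :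
    ∃ (K : ℕ) (v : Fin n → ℕ → Fin m → ℝ), reach K v Θ = 1 := by
  choose k u hu using fun j : Fin n => hΘ 0 (Pi.single j 1)
  let K := Finset.univ.sup k
  refine ⟨K, fun j i => if i < K - k j then 0 else u j (i - (K - k j)), ?_⟩
  ext i j
  have hk : k j ≤ K := Finset.le_sup (Finset.mem_univ j)
  have h := state_delay Θ.A Θ.B (u j) (K - k j) (k j)
  rw [Nat.sub_add_cancel hk, hu] at h
  simp only [reach, Matrix.of_apply, h, Matrix.one_apply, Pi.single_apply]

/-- Trajectories from 0 are transformed by Uᵀ. If the matrix is 1 at Θ, then its value at φ_U(Θ) is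
Uᵀ, so U can be read off smoothly. -/
theorem reach_rot (K : ℕ) (v : Fin n → ℕ → Fin m → ℝ) (U : Matrix.orthogonalGroup (Fin n) ℝ)
    (Θ : Ambient n m p) :
    reach K v (rot m p U Θ) = (U : Matrix (Fin n) (Fin n) ℝ)ᵀ * reach K v Θ := by
  ext i j
  have h := state_conj Θ.A _ _ Θ.B (orth_mul_transpose U) (v j) 0 K
  rw [Matrix.mulVec_zero] at h
  exact congrFun h i

theorem contDiff_state (u : ℕ → Fin m → ℝ) (k : ℕ) :
    ContDiff ℝ ∞ fun Θ : Ambient n m p => state Θ.A Θ.B u 0 k := by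
  induction k with
  | zero => exact contDiff_const
  | succ k ih =>
    simp only [state]
    refine contDiff_pi.mpr fun i => ?_
    simp only [Pi.add_apply, Matrix.mulVec, dotProduct]
    refine (ContDiff.sum fun j _ => ?_).add (ContDiff.sum fun j _ => ?_)
    · exact (contDiff_pi.mp (contDiff_pi.mp contDiff_A i) j).mul (contDiff_pi.mp ih j)
    · exact (contDiff_pi.mp (contDiff_pi.mp contDiff_B i) j).mul contDiff_const

theorem contDiff_reach (K : ℕ) (v : Fin n → ℕ → Fin m → ℝ) :
    ContDiff ℝ ∞ (reach (p := p) K v) :=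
  contDiff_pi.mpr fun i => contDiff_pi.mpr fun j => contDiff_pi.mp (contDiff_state (v j) K) i

/-! ### Congruence by an arbitrary square matrix -/

/-- The map `(A, B, C) ↦ (Uᵀ A U, Uᵀ B, C U)`, for an arbitrary square matrix `U`. -/
def congr (U : Matrix (Fin n) (Fin n) ℝ) (Θ : Ambient n m p) : Ambient n m p :=
  Ambient.mk (Uᵀ * Θ.A * U)
    (by
      rw [Matrix.IsSymm, Matrix.transpose_mul, Matrix.transpose_mul, Matrix.transpose_transpose,
        Θ.isSymm, Matrix.mul_assoc])
    (Uᵀ * Θ.B) (Θ.C * U)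

theorem congr_A (U : Matrix (Fin n) (Fin n) ℝ) (Θ : Ambient n m p) :
    (congr U Θ).A = Uᵀ * Θ.A * U := rfl

theorem congr_B (U : Matrix (Fin n) (Fin n) ℝ) (Θ : Ambient n m p) : (congr U Θ).B = Uᵀ * Θ.B := rfl

theorem congr_C (U : Matrix (Fin n) (Fin n) ℝ) (Θ : Ambient n m p) : (congr U Θ).C = Θ.C * U := rfl

theorem contDiffOn_congr {E : Type*} [NormedAddCommGroup E] [NormedSpace ℝ E] {s : Set E}
    {U : E → Matrix (Fin n) (Fin n) ℝ} {f : E → Ambient n m p} (hU : ContDiffOn ℝ ∞ U s)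
    (hf : ContDiffOn ℝ ∞ f s) : ContDiffOn ℝ ∞ (fun x => congr (U x) (f x)) s :=
  contDiffOn_ambient
    (contDiffOn_matrix_mul (contDiffOn_matrix_mul (contDiffOn_matrix_transpose hU)
      (contDiff_A.comp_contDiffOn hf)) hU)
    (contDiffOn_matrix_mul (contDiffOn_matrix_transpose hU) (contDiff_B.comp_contDiffOn hf))
    (contDiffOn_matrix_mul (contDiff_C.comp_contDiffOn hf) hU)

/-- An orthogonal matrix as an element of the orthogonal group. -/
def toOrth (U : Matrix (Fin n) (Fin n) ℝ) (hU : Uᵀ * U = 1) : Matrix.orthogonalGroup (Fin n) ℝ :=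
  ⟨U, (Matrix.mem_orthogonalGroup_iff' (Fin n) ℝ).mpr hU⟩

/-- The map `φ_U` on the ambient space, as a linear map. -/
def rotL (m p : ℕ) (U : Matrix.orthogonalGroup (Fin n) ℝ) : Ambient n m p →L[ℝ] Ambient n m p :=
  LinearMap.toContinuousLinearMap
    { toFun := rot m p U
      map_add' := fun Θ Ξ => by
        refine Ambient.ext ?_ ?_ ?_ <;>
          simp only [rot_A, rot_B, rot_C, Ambient.add_A, Ambient.add_B, Ambient.add_C,
            Matrix.mul_add, Matrix.add_mul]
      map_smul' := fun c Θ => by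
        refine Ambient.ext ?_ ?_ ?_ <;>
          simp only [rot_A, rot_B, rot_C, Ambient.smul_A, Ambient.smul_B, Ambient.smul_C,
            Matrix.mul_smul, Matrix.smul_mul, RingHom.id_apply] }

/-! ### The vertical space -/

/-- The infinitesimal action `Ω ↦ (A Ω - Ω A, -Ω B, C Ω)` of skew-symmetric matrices at
`(A, B, C)`. -/
def vert (Θ : Ambient n m p) : SkewMat n →L[ℝ] Ambient n m p :=
  LinearMap.toContinuousLinearMap
    { toFun := fun Ω => Ambient.mk (Θ.A * Ω.mat - Ω.mat * Θ.A)
        (by rw [Matrix.IsSymm, Matrix.transpose_sub, Matrix.transpose_mul, Matrix.transpose_mul,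
              skewMat_transpose, Θ.isSymm]
            simp only [Matrix.neg_mul, Matrix.mul_neg]
            abel) (-(Ω.mat * Θ.B)) (Θ.C * Ω.mat)
      map_add' := fun Ω Ω' => by
        refine Ambient.ext ?_ ?_ ?_
        · change Θ.A * (Ω.mat + Ω'.mat) - (Ω.mat + Ω'.mat) * Θ.A
            = (Θ.A * Ω.mat - Ω.mat * Θ.A) + (Θ.A * Ω'.mat - Ω'.mat * Θ.A)
          rw [Matrix.mul_add, Matrix.add_mul]
          abel
        · change -((Ω.mat + Ω'.mat) * Θ.B) = -(Ω.mat * Θ.B) + -(Ω'.mat * Θ.B)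
          rw [Matrix.add_mul, neg_add]
        · change Θ.C * (Ω.mat + Ω'.mat) = Θ.C * Ω.mat + Θ.C * Ω'.mat
          rw [Matrix.mul_add]
      map_smul' := fun c Ω => by
        refine Ambient.ext ?_ ?_ ?_
        · change Θ.A * (c • Ω.mat) - (c • Ω.mat) * Θ.A
            = c • (Θ.A * Ω.mat - Ω.mat * Θ.A)
          rw [Matrix.mul_smul, Matrix.smul_mul, smul_sub]
        · change -((c • Ω.mat) * Θ.B) = c • -(Ω.mat * Θ.B)
          rw [Matrix.smul_mul, smul_neg]
        · change Θ.C * (c • Ω.mat) = c • (Θ.C * Ω.mat)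
          rw [Matrix.mul_smul] }

theorem vert_A (Θ : Ambient n m p) (Ω : SkewMat n) : (vert Θ Ω).A = Θ.A * Ω.mat - Ω.mat * Θ.A := rfl
theorem vert_B (Θ : Ambient n m p) (Ω : SkewMat n) : (vert Θ Ω).B = -(Ω.mat * Θ.B) := rfl
theorem vert_C (Θ : Ambient n m p) (Ω : SkewMat n) : (vert Θ Ω).C = Θ.C * Ω.mat := rfl

theorem contDiff_vert : ContDiff ℝ ∞ (vert (n := n) (m := m) (p := p)) := by
  refine contDiff_clm_apply_iff.mpr fun Ω => ?_
  rw [← contDiffOn_univ]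
  refine contDiffOn_ambient ?_ ?_ ?_
  · simp only [vert_A]
    exact (contDiffOn_matrix_mul contDiff_A.contDiffOn contDiffOn_const).sub
      (contDiffOn_matrix_mul contDiffOn_const contDiff_A.contDiffOn)
  · simp only [vert_B]
    exact (contDiffOn_matrix_mul contDiffOn_const contDiff_B.contDiffOn).neg
  · simp only [vert_C]
    exact contDiffOn_matrix_mul contDiff_C.contDiffOn contDiffOn_const

theorem hasDerivAt_congr {U : ℝ → Matrix (Fin n) (Fin n) ℝ} {Ω : SkewMat n} {t : ℝ}
    (hU : HasDerivAt U Ω t) (h1 : U t = 1) (Θ : Ambient n m p) :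
    HasDerivAt (fun t => congr (U t) Θ) (vert Θ Ω) t := by
  have hT := hasDerivAt_matrix_transpose hU
  refine hasDerivAt_ambient ?_ ?_ ?_
  · have := hasDerivAt_matrix_mul (hasDerivAt_matrix_mul hT (hasDerivAt_const t Θ.A)) hU
    refine this.congr_deriv ?_
    simp only [h1, skewMat_transpose, vert_A, Matrix.transpose_one, Matrix.mul_one, Matrix.one_mul,
      Matrix.mul_zero, add_zero, Matrix.neg_mul]
    abel
  · refine (hasDerivAt_matrix_mul hT (hasDerivAt_const t Θ.B)).congr_deriv ?_
    simp only [skewMat_transpose, vert_B, Matrix.mul_zero, add_zero, Matrix.neg_mul]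
  · refine (hasDerivAt_matrix_mul (hasDerivAt_const t Θ.C) hU).congr_deriv ?_
    simp only [vert_C, Matrix.zero_mul, zero_add]

/-- If Ωx = x, then x·x = x·Ωx, which vanishes because Ω is skew. -/
theorem det_one_sub_ne_zero (Ω : SkewMat n) :
    (1 - Ω.mat).det ≠ 0 := by
  intro h
  obtain ⟨x, hx0, hx⟩ := Matrix.exists_mulVec_eq_zero_iff.mpr h
  rw [Matrix.sub_mulVec, Matrix.one_mulVec, sub_eq_zero] at hx
  have h1 : x ⬝ᵥ (Ω.mat *ᵥ x) = 0 := by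
    have h2 : x ⬝ᵥ (Ω.mat *ᵥ x)
        = -(x ⬝ᵥ (Ω.mat *ᵥ x)) := by
      conv_lhs => rw [Matrix.dotProduct_mulVec, ← Matrix.mulVec_transpose, skewMat_transpose,
        Matrix.neg_mulVec, neg_dotProduct, dotProduct_comm]
    linarith
  rw [← hx, dotProduct_self_eq_zero] at h1
  exact hx0 h1

/-- The Cayley transform of a skew-symmetric matrix. -/
def cayley (Ω : SkewMat n) : Matrix (Fin n) (Fin n) ℝ :=
  (1 - Ω.mat)⁻¹ * (1 + Ω.mat)

/-- Transposition exchanges 1 − Ω and 1 + Ω, and these commute. The Cayley transform thus supplies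
orthogonal curves that are smooth on all of ℝ. -/
theorem cayley_transpose_mul (Ω : SkewMat n) : (cayley Ω)ᵀ * cayley Ω = 1 := by
  set X : Matrix (Fin n) (Fin n) ℝ := Ω.mat with hX
  have h1 : IsUnit (1 - X).det := isUnit_iff_ne_zero.mpr (det_one_sub_ne_zero Ω)
  have h2 : IsUnit (1 + X).det := by
    have := det_one_sub_ne_zero (-Ω)
    rw [SkewMat.mat_neg, sub_neg_eq_add] at this
    exact isUnit_iff_ne_zero.mpr this
  have hc : (1 + X)⁻¹ * (1 - X)⁻¹ = (1 - X)⁻¹ * (1 + X)⁻¹ := by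
    rw [← Matrix.mul_inv_rev, ← Matrix.mul_inv_rev]
    congr 1
    noncomm_ring
  rw [cayley, ← hX, Matrix.transpose_mul, Matrix.transpose_nonsing_inv, Matrix.transpose_add,
    Matrix.transpose_sub, Matrix.transpose_one, hX, skewMat_transpose, ← hX, sub_neg_eq_add,
    ← sub_eq_add_neg]
  calc (1 - X) * (1 + X)⁻¹ * ((1 - X)⁻¹ * (1 + X))
      = (1 - X) * ((1 + X)⁻¹ * (1 - X)⁻¹) * (1 + X) := by simp only [Matrix.mul_assoc]
    _ = ((1 - X) * (1 - X)⁻¹) * ((1 + X)⁻¹ * (1 + X)) := by rw [hc]; simp only [Matrix.mul_assoc]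
    _ = 1 := by rw [Matrix.mul_nonsing_inv _ h1, Matrix.nonsing_inv_mul _ h2, Matrix.one_mul]

theorem contDiff_cayley (Ω : SkewMat n) : ContDiff ℝ ∞ fun t : ℝ => cayley ((t / 2) • Ω) := by
  have h : ContDiff ℝ ∞ fun t : ℝ => (t / 2) • Ω.mat :=
    (contDiff_id.div_const 2).smul contDiff_const
  rw [← contDiffOn_univ]
  exact contDiffOn_matrix_mul (contDiffOn_matrix_inv (contDiff_const.sub h).contDiffOn
    fun t _ => det_one_sub_ne_zero _) (contDiff_const.add h).contDiffOn

theorem cayley_zero : cayley (0 : SkewMat n) = 1 := by simp [cayley, SkewMat.mat_zero]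

/-- The Cayley transform has derivative 2Ω at 0 in the direction Ω, hence the parameter t/2. The
velocity D comes from differentiating (1 − tΩ/2) U(t) = 1 + tΩ/2 at 0, which gives D − Ω/2 = Ω/2. -/
theorem hasDerivAt_cayley (Ω : SkewMat n) :
    HasDerivAt (fun t : ℝ => cayley ((t / 2) • Ω)) Ω.mat 0 := by
  obtain ⟨D, hD⟩ : ∃ D, HasDerivAt (fun t : ℝ => cayley ((t / 2) • Ω)) D 0 :=
    ⟨_, ((contDiff_cayley Ω).differentiable (by simp)).differentiableAt.hasDerivAt⟩
  have hl : HasDerivAt (fun t : ℝ => (t / 2) • Ω.mat)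
      ((1 / 2 : ℝ) • Ω.mat) 0 :=
    ((hasDerivAt_id (0 : ℝ)).div_const 2).smul_const _
  have h1 := hasDerivAt_matrix_mul (hl.const_sub 1) hD
  have h2 := hl.const_add 1
  have he : (fun t : ℝ => (1 - (t / 2) • Ω.mat) * cayley ((t / 2) • Ω))
      = fun t : ℝ => 1 + (t / 2) • Ω.mat := by
    funext t
    have h := isUnit_iff_ne_zero.mpr (det_one_sub_ne_zero ((t / 2) • Ω))
    rw [SkewMat.mat_smul] at h
    rw [cayley, SkewMat.mat_smul, ← Matrix.mul_assoc, Matrix.mul_nonsing_inv _ h, Matrix.one_mul]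
  rw [he] at h1
  have h3 := h1.unique h2
  simp only [zero_div, zero_smul, cayley_zero, Matrix.mul_one, sub_zero, Matrix.one_mul] at h3
  have h4 : D = Ω.mat := by
    have : D = (1 / 2 : ℝ) • Ω.mat
        + (1 / 2 : ℝ) • Ω.mat := by
      nth_rewrite 1 [← h3]
      abel
    rw [this, ← add_smul]
    norm_num
  rwa [h4] at hD

/-- Infinitesimally, the reached states rotate by `-Ω`. -/
theorem fderiv_reach_vert {K : ℕ} {v : Fin n → ℕ → Fin m → ℝ} {Θ : Ambient n m p}
    (h : reach K v Θ = 1) (Ω : SkewMat n) :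
    fderiv ℝ (reach K v) Θ (vert Θ Ω) = -Ω.mat := by
  let U : ℝ → Matrix (Fin n) (Fin n) ℝ := fun t => cayley ((t / 2) • Ω)
  have hU0 : U 0 = 1 := by simp [U, cayley_zero]
  have hc := hasDerivAt_congr (hasDerivAt_cayley Ω) hU0 Θ
  have hc0 : congr (U 0) Θ = Θ := by
    rw [hU0]
    refine Ambient.ext ?_ ?_ ?_ <;> simp [congr_A, congr_B, congr_C]
  have hS : HasFDerivAt (reach K v) (fderiv ℝ (reach K v) Θ) (congr (U 0) Θ) := by
    rw [hc0]
    exact ((contDiff_reach K v).differentiable (by simp)).differentiableAt.hasFDerivAt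
  have h1 := hS.comp_hasDerivAt (0 : ℝ) hc
  have h2 := hasDerivAt_matrix_transpose (hasDerivAt_cayley Ω)
  -- Equivariance and `reach K v Θ = 1` give Uᵀ along the orbit curve; its derivative is Ωᵀ = −Ω.
  have he : reach K v ∘ (fun t => congr (U t) Θ) = fun t => (U t)ᵀ := by
    funext t
    have := reach_rot K v (toOrth (U t) (cayley_transpose_mul _)) Θ
    rwa [h, Matrix.mul_one] at this
  rw [he] at h1
  exact (h1.unique h2).trans (skewMat_transpose Ω)

/-- The derivative of the reached states recovers −Ω from `vert Θ Ω`: the action is infinitesimally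
free. -/
theorem vert_injective {Θ : Ambient n m p} (hΘ : IsControllable Θ.A Θ.B) :
    Function.Injective (vert Θ) := by
  obtain ⟨K, v, h⟩ := exists_reach_eq_one hΘ
  rw [injective_iff_map_eq_zero]
  intro Ω hΩ
  have := fderiv_reach_vert h Ω
  rw [hΩ, map_zero] at this
  exact SkewMat.ext (neg_eq_zero.mp this.symm)

theorem proj_eq_iff {Θ₁ Θ₂ : N n m p} :
    proj n m p Θ₁ = proj n m p Θ₂ ↔ ∃ U : Matrix.orthogonalGroup (Fin n) ℝ, Θ₂ = act U Θ₁ :=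
  Quotient.eq (r := orbitSetoid n m p)

theorem proj_act (U : Matrix.orthogonalGroup (Fin n) ℝ) (Θ : N n m p) :
    proj n m p (act U Θ) = proj n m p Θ :=
  (proj_eq_iff.mpr ⟨U, rfl⟩).symm

/-- The vertical space consists of the velocities of the infinitesimal action. -/
theorem vertical_eq_range (Θ : N n m p) : vertical Θ = Set.range (vert (Θ : Ambient n m p)) := by
  ext w
  constructor
  · rintro ⟨γ, hγ0, hγ, hsmooth, rfl⟩
    obtain ⟨K, v, h⟩ := exists_reach_eq_one Θ.2.2.1
    -- A curve in the fiber provides a group element for each t separately. Reading it off from the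
    -- reached states shows that it depends smoothly on t.
    let U : ℝ → Matrix (Fin n) (Fin n) ℝ := fun t => (reach K v (γ t : Ambient n m p))ᵀ
    have hU : ∀ t, (U t)ᵀ * U t = 1 ∧ (γ t : Ambient n m p) = congr (U t) Θ := by
      intro t
      obtain ⟨V, hV⟩ := proj_eq_iff.mp (hγ t).symm
      have h1 : (γ t : Ambient n m p) = rot m p V Θ := congrArg Subtype.val hV
      have h2 : U t = (V : Matrix (Fin n) (Fin n) ℝ) := by
        simp only [U]
        rw [h1, reach_rot, h, Matrix.mul_one, Matrix.transpose_transpose]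
      rw [h2]
      exact ⟨orth_transpose_mul V, h1⟩
    have hUs : ContDiff ℝ ∞ U := by
      rw [← contDiffOn_univ]
      exact contDiffOn_matrix_transpose ((contDiff_reach K v).comp hsmooth).contDiffOn
    have hU0 : U 0 = 1 := by
      simp only [U]
      rw [hγ0, h, Matrix.transpose_one]
    have hd : HasDerivAt U (deriv U 0) 0 :=
      (hUs.differentiable (by simp)).differentiableAt.hasDerivAt
    have hskew : (deriv U 0)ᵀ = -deriv U 0 := by
      -- Differentiating UᵀU = 1 at U(0) = 1 shows that the velocity is skew.
      have h3 := hasDerivAt_matrix_mul (hasDerivAt_matrix_transpose hd) hd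
      have he : (fun t => (U t)ᵀ * U t) = fun _ => 1 := funext fun t => (hU t).1
      rw [he] at h3
      have h4 := h3.unique (hasDerivAt_const (0 : ℝ) (1 : Matrix (Fin n) (Fin n) ℝ))
      rw [hU0, Matrix.mul_one, Matrix.transpose_one, Matrix.one_mul] at h4
      exact eq_neg_of_add_eq_zero_left h4
    have hc := hasDerivAt_congr (Ω := SkewMat.mk (deriv U 0) hskew) hd hU0 (Θ : Ambient n m p)
    have he : (fun t => (γ t : Ambient n m p)) = fun t => congr (U t) (Θ : Ambient n m p) :=
      funext fun t => (hU t).2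
    exact ⟨SkewMat.mk (deriv U 0) hskew, by rw [he, hc.deriv]⟩
  · rintro ⟨Ω, rfl⟩
    let V : ℝ → Matrix.orthogonalGroup (Fin n) ℝ := fun t =>
      toOrth (cayley ((t / 2) • Ω)) (cayley_transpose_mul _)
    have hV0 : V 0 = 1 := Subtype.ext (by simp [V, toOrth, cayley_zero])
    refine ⟨fun t => act (V t) Θ, (congrArg (act · Θ) hV0).trans (act_one Θ), fun t => proj_act _ _, ?_, ?_⟩
    · rw [← contDiffOn_univ]
      exact contDiffOn_congr (contDiff_cayley Ω).contDiffOn contDiffOn_const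
    · exact (hasDerivAt_congr (hasDerivAt_cayley Ω) (by simp [cayley_zero])
        (Θ : Ambient n m p)).deriv

end

/-! ### Polar normalisation and slices for the action. -/

section

variable {n m p : ℕ}

/-! ### Square roots of symmetric matrices close to the identity -/

/-- The identity matrix as a symmetric matrix. -/
def symOne (n : ℕ) : SymMat n := ⟨1, Matrix.isSymm_one⟩

/-- Squaring is a diffeomorphism of symmetric matrices near the identity. -/
theorem exists_local_sqrt (n : ℕ) : ∃ φ : OpenPartialHomeomorph (SymMat n) (SymMat n),
    symOne n ∈ φ.source ∧ (∀ X ∈ φ.source, (X : Matrix (Fin n) (Fin n) ℝ).det ≠ 0) ∧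
      (∀ X, (φ X : Matrix (Fin n) (Fin n) ℝ) = X * X) ∧ ContDiffOn ℝ ∞ φ.symm φ.target := by
  let ι : SymMat n →L[ℝ] Matrix (Fin n) (Fin n) ℝ := (SymMat n).subtypeL
  let g : SymMat n → SymMat n := fun X => symPart n (ι X * ι X)
  have hg : ContDiffOn ℝ ∞ g Set.univ :=
    (symPart n).contDiff.comp_contDiffOn
      (contDiffOn_matrix_mul ι.contDiff.contDiffOn ι.contDiff.contDiffOn)
  have hgc : ∀ X, (g X : Matrix (Fin n) (Fin n) ℝ) = X * X := by
    intro X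
    have h : (X : Matrix (Fin n) (Fin n) ℝ)ᵀ = X := X.2
    change (1 / 2 : ℝ) • (X.1 * X.1 + (X.1 * X.1)ᵀ) = _
    rw [Matrix.transpose_mul, h, ← two_smul ℝ, smul_smul]
    norm_num
  -- The derivative of X ↦ X² at 1 is Y ↦ Y + Y, which is invertible.
  let e : SymMat n ≃L[ℝ] SymMat n := ContinuousLinearEquiv.smulLeft (Units.mk0 (2 : ℝ) two_ne_zero)
  have he : HasFDerivAt g (e : SymMat n →L[ℝ] SymMat n) (symOne n) := by
    have h1 : HasFDerivAt g (fderiv ℝ g (symOne n)) (symOne n) :=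
      ((hg.contDiffAt Filter.univ_mem).differentiableAt (by simp)).hasFDerivAt
    refine h1.congr_fderiv ?_
    ext1 Y
    have hl : HasDerivAt (fun t : ℝ => symOne n + t • Y) Y 0 := by
      have h := ((hasDerivAt_id (0 : ℝ)).smul_const Y).const_add (symOne n)
      rwa [one_smul] at h
    have h1' : HasFDerivAt g (fderiv ℝ g (symOne n)) (symOne n + (0 : ℝ) • Y) := by
      rwa [zero_smul, add_zero]
    have h2 := h1'.comp_hasDerivAt (0 : ℝ) hl
    have hι : HasDerivAt (fun t : ℝ => ι (symOne n + t • Y)) (ι Y) 0 :=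
      ι.hasFDerivAt.comp_hasDerivAt (0 : ℝ) hl
    have h3 := (symPart n).hasFDerivAt.comp_hasDerivAt (0 : ℝ) (hasDerivAt_matrix_mul hι hι)
    refine (h2.unique h3).trans ?_
    have h5 : ι (symOne n + (0 : ℝ) • Y) = 1 := by rw [zero_smul, add_zero]; rfl
    rw [h5, Matrix.mul_one, Matrix.one_mul, ← two_smul ℝ]
    refine ((symPart n).map_smul (2 : ℝ) (ι Y)).trans ?_
    change (2 : ℝ) • symPart n (Y : Matrix (Fin n) (Fin n) ℝ) = (2 : ℝ) • Y
    rw [symPart_coe]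
  -- The domain is cut down to invertible matrices, since the polar factor needs the inverse of the
  -- root.
  have hO : IsOpen {X : SymMat n | (ι X).det ≠ 0} :=
    isOpen_ne_fun (ι.continuous.matrix_det) continuous_const
  obtain ⟨φ, h1, h2, h3, -, h5⟩ := exists_smooth_openPartialHomeomorph hO
    (x := symOne n) (by simp [ι, symOne]) (hg.mono (Set.subset_univ _)) e he
  exact ⟨φ, h1, fun X hX => h2 hX, fun X => (congrArg Subtype.val (congrFun h3 X)).trans (hgc X), h5⟩

/-! ### Normalising the orthogonal ambiguity -/

section Normalize

variable (φ : OpenPartialHomeomorph (SymMat n) (SymMat n)) (K : ℕ) (v : Fin n → ℕ → Fin m → ℝ)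

/-- The Gram matrix of the reached states. -/
def gram (Θ : Ambient n m p) : SymMat n := symPart n ((reach K v Θ)ᵀ * reach K v Θ)

/-- The orthogonal factor in the polar decomposition of the matrix of reached states. -/
def polar (Θ : Ambient n m p) : Matrix (Fin n) (Fin n) ℝ :=
  reach K v Θ * (φ.symm (gram K v Θ) : Matrix (Fin n) (Fin n) ℝ)⁻¹

/-- The point of the orbit for which the matrix of reached states is symmetric. -/
def normalize (Θ : Ambient n m p) : Ambient n m p := congr (polar φ K v Θ) Θ

theorem coe_gram (Θ : Ambient n m p) :
    (gram K v Θ : Matrix (Fin n) (Fin n) ℝ) = (reach K v Θ)ᵀ * reach K v Θ := by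
  rw [gram, coe_symPart, Matrix.transpose_mul, Matrix.transpose_transpose, ← two_smul ℝ, smul_smul]
  norm_num

theorem gram_rot (U : Matrix.orthogonalGroup (Fin n) ℝ) (Θ : Ambient n m p) :
    gram K v (rot m p U Θ) = gram K v Θ := by
  refine Subtype.ext ?_
  rw [coe_gram, coe_gram, reach_rot, Matrix.transpose_mul, Matrix.transpose_transpose,
    Matrix.mul_assoc, ← Matrix.mul_assoc _ _ (reach K v Θ), orth_mul_transpose, Matrix.one_mul]

theorem polar_rot (U : Matrix.orthogonalGroup (Fin n) ℝ) (Θ : Ambient n m p) :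
    polar φ K v (rot m p U Θ) = (U : Matrix (Fin n) (Fin n) ℝ)ᵀ * polar φ K v Θ := by
  rw [polar, gram_rot, reach_rot, Matrix.mul_assoc, polar]

/-- The polar factor R of Θ becomes UᵀR at φ_U(Θ), so the two occurrences of U cancel and the
normalised point depends only on the orbit. -/
theorem normalize_rot (U : Matrix.orthogonalGroup (Fin n) ℝ) (Θ : Ambient n m p) :
    normalize φ K v (rot m p U Θ) = normalize φ K v Θ := by
  have h : ∀ X : Matrix (Fin n) (Fin n) ℝ, (U : Matrix (Fin n) (Fin n) ℝ) *
      ((U : Matrix (Fin n) (Fin n) ℝ)ᵀ * X) = X := fun X => by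
    rw [← Matrix.mul_assoc, orth_mul_transpose, Matrix.one_mul]
  have h' : ∀ X : Matrix (Fin n) (Fin m) ℝ, (U : Matrix (Fin n) (Fin n) ℝ) *
      ((U : Matrix (Fin n) (Fin n) ℝ)ᵀ * X) = X := fun X => by
    rw [← Matrix.mul_assoc, orth_mul_transpose, Matrix.one_mul]
  refine Ambient.ext ?_ ?_ ?_ <;>
    simp only [normalize, congr_A, congr_B, congr_C, rot_A, rot_B, rot_C, polar_rot,
      Matrix.transpose_mul, Matrix.transpose_transpose, Matrix.mul_assoc, h, h']

variable {φ K v} (hφ : ∀ X, (φ X : Matrix (Fin n) (Fin n) ℝ) = X * X)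
  (hφd : ∀ X ∈ φ.source, (X : Matrix (Fin n) (Fin n) ℝ).det ≠ 0)

include hφ hφd

/-- With X² = SᵀS and R = S X⁻¹, the product is RᵀS = X⁻¹SᵀS = X. This gives RᵀR = 1, and S becomes
the symmetric matrix X at the normalised point. -/
theorem transpose_polar_mul_reach {Θ : Ambient n m p} (hΘ : gram K v Θ ∈ φ.target) :
    (polar φ K v Θ)ᵀ * reach K v Θ = (φ.symm (gram K v Θ) : Matrix (Fin n) (Fin n) ℝ) := by
  have hd := isUnit_iff_ne_zero.mpr (hφd _ (φ.map_target hΘ))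
  have h1 := hφ (φ.symm (gram K v Θ))
  rw [φ.right_inv hΘ, coe_gram] at h1
  have hs : (φ.symm (gram K v Θ) : Matrix (Fin n) (Fin n) ℝ)ᵀ
      = (φ.symm (gram K v Θ) : Matrix (Fin n) (Fin n) ℝ) := (φ.symm (gram K v Θ)).2
  rw [polar, Matrix.transpose_mul, Matrix.transpose_nonsing_inv, hs, Matrix.mul_assoc, h1,
    ← Matrix.mul_assoc, Matrix.nonsing_inv_mul _ hd, Matrix.one_mul]

theorem polar_transpose_mul {Θ : Ambient n m p} (hΘ : gram K v Θ ∈ φ.target) :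
    (polar φ K v Θ)ᵀ * polar φ K v Θ = 1 := by
  have hd := isUnit_iff_ne_zero.mpr (hφd _ (φ.map_target hΘ))
  have h := transpose_polar_mul_reach hφ hφd hΘ
  calc (polar φ K v Θ)ᵀ * polar φ K v Θ
      = (polar φ K v Θ)ᵀ * reach K v Θ * (φ.symm (gram K v Θ) : Matrix (Fin n) (Fin n) ℝ)⁻¹ := by
        rw [Matrix.mul_assoc]; rfl
    _ = 1 := by rw [h, Matrix.mul_nonsing_inv _ hd]

theorem normalize_eq_rot {Θ : Ambient n m p} (hΘ : gram K v Θ ∈ φ.target) :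
    ∃ U : Matrix.orthogonalGroup (Fin n) ℝ, normalize φ K v Θ = rot m p U Θ :=
  ⟨toOrth _ (polar_transpose_mul hφ hφd hΘ), rfl⟩

theorem reach_normalize {Θ : Ambient n m p} (hΘ : gram K v Θ ∈ φ.target) :
    reach K v (normalize φ K v Θ) = (φ.symm (gram K v Θ) : Matrix (Fin n) (Fin n) ℝ) := by
  have h := reach_rot K v (toOrth _ (polar_transpose_mul hφ hφd hΘ)) Θ
  exact h.trans (transpose_polar_mul_reach hφ hφd hΘ)

omit hφd in
theorem gram_eq_of_reach_eq {Θ : Ambient n m p} {Y : SymMat n} (h : reach K v Θ = Y) :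
    gram K v Θ = φ Y := by
  have hY : (Y : Matrix (Fin n) (Fin n) ℝ)ᵀ = Y := Y.2
  refine Subtype.ext ?_
  rw [coe_gram, hφ, h, hY]

/-- A symmetric S = Y has Gram matrix Y². On `φ.source` the chosen branch of the root returns Y
itself, so the polar factor is 1. -/
theorem normalize_eq_self {Θ : Ambient n m p} {Y : SymMat n} (hY : Y ∈ φ.source)
    (h : reach K v Θ = Y) : normalize φ K v Θ = Θ := by
  have h1 : polar φ K v Θ = 1 := by
    rw [polar, gram_eq_of_reach_eq hφ h, φ.left_inv hY, h,
      Matrix.mul_nonsing_inv _ (isUnit_iff_ne_zero.mpr (hφd _ hY))]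
  refine Ambient.ext ?_ ?_ ?_ <;> simp [normalize, congr_A, congr_B, congr_C, h1]

omit hφ in
theorem contDiffOn_normalize (hφs : ContDiffOn ℝ ∞ φ.symm φ.target) :
    ContDiffOn ℝ ∞ (normalize (p := p) φ K v) {Θ | gram K v Θ ∈ φ.target} := by
  have hS := (contDiff_reach (p := p) K v).contDiffOn (s := {Θ | gram K v Θ ∈ φ.target})
  have hG : ContDiffOn ℝ ∞ (gram (p := p) K v) {Θ | gram K v Θ ∈ φ.target} :=
    (symPart n).contDiff.comp_contDiffOn
      (contDiffOn_matrix_mul (contDiffOn_matrix_transpose hS) hS)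
  have hX : ContDiffOn ℝ ∞ (fun Θ : Ambient n m p =>
      (φ.symm (gram K v Θ) : Matrix (Fin n) (Fin n) ℝ)) {Θ | gram K v Θ ∈ φ.target} :=
    (SymMat n).subtypeL.contDiff.comp_contDiffOn (hφs.comp hG fun Θ hΘ => hΘ)
  exact contDiffOn_congr (contDiffOn_matrix_mul hS (contDiffOn_matrix_inv hX fun Θ hΘ =>
    hφd _ (φ.map_target hΘ))) contDiffOn_id

end Normalize

theorem continuous_gram (K : ℕ) (v : Fin n → ℕ → Fin m → ℝ) :
    Continuous (gram (p := p) K v) := by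
  have h := (contDiff_reach (p := p) K v).continuous
  exact (symPart n).continuous.comp (h.matrix_transpose.matrix_mul h)

/-! ### Slices -/

/-- A slice for the action at `Θ₀`: an invariant open set `U` with an invariant smooth map `f` to an
open set `B` of the model space, which separates orbits and has a smooth section `s`. -/
structure Slice (Θ₀ : N n m p) where
  /-- An invariant open set. -/
  U : Set (Ambient n m p)
  /-- The image of the invariant open set in the model space. -/
  B : Set (EuclideanSpace ℝ (Fin (qdim n m p)))
  /-- The invariant coordinates. -/
  f : Ambient n m p → EuclideanSpace ℝ (Fin (qdim n m p))
  /-- The section. -/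
  s : EuclideanSpace ℝ (Fin (qdim n m p)) → Ambient n m p
  isOpen_U : IsOpen U
  isOpen_B : IsOpen B
  subset : ∀ Θ ∈ U, Θ ∈ N n m p
  mem : (Θ₀ : Ambient n m p) ∈ U
  rot_mem : ∀ V, ∀ Θ ∈ U, rot m p V Θ ∈ U
  f_rot : ∀ V, ∀ Θ ∈ U, f (rot m p V Θ) = f Θ
  contDiffOn_f : ContDiffOn ℝ ∞ f U
  contDiffOn_s : ContDiffOn ℝ ∞ s B
  f_mem : ∀ Θ ∈ U, f Θ ∈ B
  s_mem : ∀ h ∈ B, s h ∈ U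
  f_s : ∀ h ∈ B, f (s h) = h
  s_f : ∀ Θ ∈ U, ∃ V, s (f Θ) = rot m p V Θ
  surjective_fderiv : Function.Surjective (fderiv ℝ f Θ₀)

theorem rot_mem_N {U : Matrix.orthogonalGroup (Fin n) ℝ} {Θ : Ambient n m p}
    (hΘ : Θ ∈ N n m p) : rot m p U Θ ∈ N n m p := rot_mem U hΘ

/-- Stated on the whole ambient space because it serves to prove that Θ lies in N. -/
theorem exists_rot_rot_eq (W : Matrix.orthogonalGroup (Fin n) ℝ) (Θ : Ambient n m p) :
    ∃ W', rot m p W' (rot m p W Θ) = Θ := by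
  have h := orth_mul_transpose W
  have hA : ∀ X : Matrix (Fin n) (Fin n) ℝ, (W : Matrix (Fin n) (Fin n) ℝ) *
      ((W : Matrix (Fin n) (Fin n) ℝ)ᵀ * X) = X := fun X => by
    rw [← Matrix.mul_assoc, h, Matrix.one_mul]
  have hB : ∀ X : Matrix (Fin n) (Fin m) ℝ, (W : Matrix (Fin n) (Fin n) ℝ) *
      ((W : Matrix (Fin n) (Fin n) ℝ)ᵀ * X) = X := fun X => by
    rw [← Matrix.mul_assoc, h, Matrix.one_mul]
  refine ⟨toOrth (W : Matrix (Fin n) (Fin n) ℝ)ᵀ (by rw [Matrix.transpose_transpose, h]), ?_⟩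
  refine Ambient.ext ?_ ?_ ?_ <;>
    simp only [rot_A, rot_B, rot_C, toOrth, Matrix.transpose_transpose, Matrix.mul_assoc, hA, hB, h,
      Matrix.mul_one]

/-- The slice consists of the points near Θ₀ with symmetric matrix of reached states. The
normalisation ρ retracts a neighbourhood of the orbit onto it along orbits, so coordinates of the
slice composed with ρ are invariant and separate orbits. -/
theorem exists_slice (Θ₀ : N n m p) : Nonempty (Slice Θ₀) := by
  obtain ⟨φ, hφ1, hφd, hφ, hφs⟩ := exists_local_sqrt n
  obtain ⟨K, v, hΘ₀⟩ := exists_reach_eq_one Θ₀.2.2.1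
  -- P supplies coordinates transverse to the orbit: its kernel is exactly the vertical space at Θ₀.
  obtain ⟨P, hP⟩ := exists_ker_eq_range (F := EuclideanSpace ℝ (Fin (qdim n m p)))
    (vert (Θ₀ : Ambient n m p)) (vert_injective Θ₀.2.2.1)
    (by rw [finrank_euclideanSpace_fin]; exact finrank_ambient n m p)
  let O : Set (Ambient n m p) := {Θ | Θ ∈ N n m p ∧ symPart n (reach K v Θ) ∈ φ.source}
  have hO : IsOpen O := (N n m p).isOpen.inter (φ.open_source.preimage
    ((symPart n).continuous.comp (contDiff_reach K v).continuous))
  have hone : symPart n (reach K v (Θ₀ : Ambient n m p)) = symOne n := by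
    rw [hΘ₀]; exact symPart_coe (symOne n)
  have hΘ₀O : (Θ₀ : Ambient n m p) ∈ O := ⟨Θ₀.2, by rw [hone]; exact hφ1⟩
  -- The second component vanishes exactly where S is symmetric; on that set P gives the
  -- coordinates.
  let g : Ambient n m p → EuclideanSpace ℝ (Fin (qdim n m p)) × SkewMat n :=
    fun Θ => (P (Θ - Θ₀), skewPart n (reach K v Θ))
  have hg : ContDiff ℝ ∞ g :=
    (P.contDiff.comp (contDiff_id.sub contDiff_const)).prodMk
      ((skewPart n).contDiff.comp (contDiff_reach K v))
  let D : Ambient n m p →L[ℝ] EuclideanSpace ℝ (Fin (qdim n m p)) × SkewMat n :=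
    P.prod ((skewPart n).comp (fderiv ℝ (reach K v) Θ₀))
  have hD : HasFDerivAt g D Θ₀ := by
    refine HasFDerivAt.prodMk ?_ ?_
    · exact P.hasFDerivAt.comp (Θ₀ : Ambient n m p) ((hasFDerivAt_id _).sub_const _)
    · exact (skewPart n).hasFDerivAt.comp (Θ₀ : Ambient n m p)
        ((contDiff_reach K v).differentiable (by simp)).differentiableAt.hasFDerivAt
  -- A vector killed by P is `vert Θ₀ Ω`, and the second component of D maps it to −Ω.
  have hDi : Function.Injective D := by
    rw [injective_iff_map_eq_zero]
    intro w hw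
    obtain ⟨Ω, rfl⟩ := (hP w).mp (congrArg Prod.fst hw)
    have h1 : skewPart n (fderiv ℝ (reach K v) Θ₀ (vert (Θ₀ : Ambient n m p) Ω)) = 0 :=
      congrArg Prod.snd hw
    rw [fderiv_reach_vert hΘ₀, map_neg, skewPart_coe, neg_eq_zero] at h1
    rw [h1, map_zero]
  obtain ⟨e, he⟩ := exists_continuousLinearEquiv_of_injective D hDi
    (by rw [Module.finrank_prod, finrank_euclideanSpace_fin]; exact finrank_ambient n m p)
  obtain ⟨ψ, hψ1, hψO, hψg, -, hψs⟩ := exists_smooth_openPartialHomeomorph hO hΘ₀O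
    hg.contDiffOn e (by rw [he]; exact hD)
  let V : Set (Ambient n m p) := {Θ | gram K v Θ ∈ φ.target}
  have hV : IsOpen V := φ.open_target.preimage (continuous_gram K v)
  let ρ := normalize (p := p) φ K v
  have hρ : ContDiffOn ℝ ∞ ρ V := contDiffOn_normalize hφd hφs
  -- points with symmetric matrix of reached states are fixed by the normalisation
  have hfix : ∀ Θ ∈ O, skewPart n (reach K v Θ) = 0 → Θ ∈ V ∧ ρ Θ = Θ := by
    intro Θ hΘ h0
    have hsym := (skewPart_eq_zero_iff _).mp h0
    have hY : reach K v Θ = (symPart n (reach K v Θ) : Matrix (Fin n) (Fin n) ℝ) :=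
      (congrArg Subtype.val (symPart_coe ⟨reach K v Θ, hsym⟩)).symm
    refine ⟨?_, normalize_eq_self hφ hφd hΘ.2 hY⟩
    change gram K v Θ ∈ φ.target
    rw [gram_eq_of_reach_eq hφ hY]
    exact φ.map_source hΘ.2
  have hskew : ∀ Θ ∈ V, skewPart n (reach K v (ρ Θ)) = 0 := by
    intro Θ hΘ
    rw [skewPart_eq_zero_iff, reach_normalize hφ hφd hΘ]
    exact (φ.symm (gram K v Θ)).2
  have hgρ : ∀ Θ ∈ V, g (ρ Θ) = (P (ρ Θ - Θ₀), 0) := fun Θ hΘ => by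
    simp only [g, hskew Θ hΘ]
  let f : Ambient n m p → EuclideanSpace ℝ (Fin (qdim n m p)) := fun Θ => P (ρ Θ - Θ₀)
  let s : EuclideanSpace ℝ (Fin (qdim n m p)) → Ambient n m p := fun h => ψ.symm (h, 0)
  have hB : ∀ h, (h, 0) ∈ ψ.target → s h ∈ V ∧ ρ (s h) = s h ∧ s h ∈ ψ.source ∧
      P (s h - Θ₀) = h := by
    intro h hh
    have h1 : s h ∈ ψ.source := ψ.map_target hh
    have h2 : g (s h) = (h, 0) := by rw [← hψg]; exact ψ.right_inv hh
    have h3 := hfix (s h) (hψO h1) (congrArg Prod.snd h2)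
    exact ⟨h3.1, h3.2, h1, congrArg Prod.fst h2⟩
  have hsf : ∀ Θ ∈ V, ρ Θ ∈ ψ.source → s (f Θ) = ρ Θ := by
    intro Θ hΘ h1
    have h2 : (f Θ, (0 : SkewMat n)) = ψ (ρ Θ) := by rw [hψg, hgρ Θ hΘ]
    simp only [s]
    rw [h2, ψ.left_inv h1]
  have hfixΘ₀ := hfix Θ₀ hΘ₀O (by
    rw [hΘ₀, skewPart_eq_zero_iff, Matrix.transpose_one])
  -- This set is invariant because the Gram matrix and ρ are.
  have hUo : IsOpen (V ∩ ρ ⁻¹' ψ.source) := hρ.continuousOn.isOpen_inter_preimage hV ψ.open_source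
  have hf : ContDiffOn ℝ ∞ f V := P.contDiff.comp_contDiffOn (hρ.sub contDiffOn_const)
  have hBo : IsOpen {h : EuclideanSpace ℝ (Fin (qdim n m p)) | (h, (0 : SkewMat n)) ∈ ψ.target} :=
    ψ.open_target.preimage (by fun_prop)
  have hs : ContDiffOn ℝ ∞ s {h | (h, 0) ∈ ψ.target} :=
    hψs.comp (contDiff_id.prodMk contDiff_const).contDiffOn fun h hh => hh
  have hΘ₀ψ : ρ Θ₀ ∈ ψ.source := by rw [hfixΘ₀.2]; exact hψ1
  have hfB : ∀ Θ ∈ V, ρ Θ ∈ ψ.source → (f Θ, 0) ∈ ψ.target := by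
    intro Θ hΘ h1
    have h2 := ψ.map_source h1
    rwa [hψg, hgρ Θ hΘ] at h2
  refine ⟨{ U := V ∩ ρ ⁻¹' ψ.source
            B := {h | (h, 0) ∈ ψ.target}
            f := f
            s := s
            isOpen_U := hUo
            isOpen_B := hBo
            subset := ?_
            mem := ⟨hfixΘ₀.1, hΘ₀ψ⟩
            rot_mem := ?_
            f_rot := ?_
            contDiffOn_f := hf.mono Set.inter_subset_left
            contDiffOn_s := hs
            f_mem := fun Θ hΘ => hfB Θ hΘ.1 hΘ.2
            s_mem := ?_
            f_s := ?_
            s_f := ?_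
            surjective_fderiv := ?_ }⟩
  -- The normalised point lies in N, and Θ is obtained from it by a rotation.
  · rintro Θ ⟨h1, h2⟩
    obtain ⟨W, hW⟩ := normalize_eq_rot hφ hφd h1
    have h3 : rot m p W Θ ∈ N n m p := by rw [← hW]; exact (hψO h2).1
    obtain ⟨W', h4⟩ := exists_rot_rot_eq W Θ
    rw [← h4]
    exact rot_mem_N h3
  · rintro W Θ ⟨h1, h2⟩
    refine ⟨?_, ?_⟩
    · change gram K v (rot m p W Θ) ∈ φ.target
      rwa [gram_rot]
    · change normalize φ K v (rot m p W Θ) ∈ ψ.source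
      rwa [normalize_rot]
  · intro W Θ _
    simp only [f, ρ, normalize_rot]
  · intro h hh
    obtain ⟨h1, h2, h3, -⟩ := hB h hh
    exact ⟨h1, by rw [Set.mem_preimage, h2]; exact h3⟩
  · intro h hh
    obtain ⟨-, h2, -, h4⟩ := hB h hh
    simp only [f]
    rw [h2, h4]
  · intro Θ hΘ
    rw [hsf Θ hΘ.1 hΘ.2]
    exact normalize_eq_rot hφ hφd hΘ.1
  -- Near 0 the composite f ∘ s is the identity, and s 0 = Θ₀, so Df(Θ₀) has the right inverse
  -- Ds(0).
  · have hf0 : f Θ₀ = 0 := by simp only [f]; rw [hfixΘ₀.2, sub_self, map_zero]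
    have hs0 : s 0 = Θ₀ := by
      rw [← hf0, hsf Θ₀ hfixΘ₀.1 hΘ₀ψ, hfixΘ₀.2]
    have h0 : (0, 0) ∈ ψ.target := by rw [← hf0]; exact hfB Θ₀ hfixΘ₀.1 hΘ₀ψ
    have hsd := ((hs.contDiffAt (hBo.mem_nhds h0)).differentiableAt (by simp)).hasFDerivAt
    have hfd : HasFDerivAt f (fderiv ℝ f Θ₀) (s 0) := by
      rw [hs0]
      exact ((hf.contDiffAt (hV.mem_nhds hfixΘ₀.1)).differentiableAt (by simp)).hasFDerivAt
    have h1 := hfd.comp 0 hsd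
    have h2 : f ∘ s =ᶠ[𝓝 0] id := by
      filter_upwards [hBo.mem_nhds h0] with h hh
      obtain ⟨-, h2, -, h4⟩ := hB h hh
      simp only [f, Function.comp_apply, id]
      rw [h2, h4]
    have h3 := h1.unique ((hasFDerivAt_id (0 : EuclideanSpace ℝ _)).congr_of_eventuallyEq h2)
    exact fun w => ⟨_, DFunLike.congr_fun h3 w⟩

end

/-! ### Topology and smooth structure of the orbit space. -/

section

variable {n m p : ℕ}

/-! ### The quotient topology -/

theorem continuous_proj : Continuous (proj n m p) := continuous_quot_mk

theorem proj_surjective : Function.Surjective (proj n m p) := Quotient.mk_surjective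

theorem continuous_ambient {X : Type*} [TopologicalSpace X] {f : X → Ambient n m p}
    (hA : Continuous fun x => (f x).A) (hB : Continuous fun x => (f x).B)
    (hC : Continuous fun x => (f x).C) : Continuous f := by
  have h := (assemble n m p).continuous.comp (hA.prodMk (hB.prodMk hC))
  have e : (assemble n m p) ∘ (fun x => ((f x).A, (f x).B, (f x).C)) = f :=
    funext fun x => assemble_components (f x)
  rwa [e] at h

theorem continuous_act {X : Type*} [TopologicalSpace X]
    {U : X → Matrix.orthogonalGroup (Fin n) ℝ} {Θ : X → N n m p} (hU : Continuous U)
    (hΘ : Continuous Θ) : Continuous fun x => act (U x) (Θ x) := by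
  have hU' : Continuous fun x => (U x : Matrix (Fin n) (Fin n) ℝ) := continuous_subtype_val.comp hU
  have hΘ' : Continuous fun x => (Θ x : Ambient n m p) := continuous_subtype_val.comp hΘ
  refine Continuous.subtype_mk (continuous_ambient ?_ ?_ ?_) _
  · exact (hU'.matrix_transpose.matrix_mul (Ambient.continuous_A.comp hΘ')).matrix_mul hU'
  · exact hU'.matrix_transpose.matrix_mul (Ambient.continuous_B.comp hΘ')
  · exact (Ambient.continuous_C.comp hΘ').matrix_mul hU'

/-- The saturation of an open set is a union of its preimages under the homeomorphisms φ_U. -/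
theorem isOpenMap_proj : IsOpenMap (proj n m p) := by
  intro W hW
  rw [← (isQuotientMap_quotient_mk' (s := orbitSetoid n m p)).isOpen_preimage]
  have h : Quotient.mk' ⁻¹' (proj n m p '' W)
      = ⋃ U : Matrix.orthogonalGroup (Fin n) ℝ, act U ⁻¹' W := by
    ext Θ
    simp only [Set.mem_preimage, Set.mem_image, Set.mem_iUnion]
    constructor
    · rintro ⟨Ξ, hΞ, h⟩
      obtain ⟨U, rfl⟩ := proj_eq_iff.mp (h.symm : proj n m p Θ = proj n m p Ξ)
      exact ⟨U, hΞ⟩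
    · rintro ⟨U, hU⟩
      exact ⟨_, hU, proj_act U Θ⟩
  rw [h]
  exact isOpen_iUnion fun U => hW.preimage (continuous_act continuous_const continuous_id)

theorem isOpenQuotientMap_proj : IsOpenQuotientMap (proj n m p) :=
  ⟨proj_surjective, continuous_proj, isOpenMap_proj⟩

instance : CompactSpace (Matrix.orthogonalGroup (Fin n) ℝ) := by
  refine isCompact_iff_compactSpace (s := (Matrix.orthogonalGroup (Fin n) ℝ :
    Set (Matrix (Fin n) (Fin n) ℝ))).mp ?_
  refine Metric.isCompact_of_isClosed_isBounded ?_ ?_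
  · have h : (Matrix.orthogonalGroup (Fin n) ℝ : Set (Matrix (Fin n) (Fin n) ℝ))
        = {U | U * Uᵀ = 1} := by
      ext U
      exact Matrix.mem_orthogonalGroup_iff (Fin n) ℝ
    rw [h]
    exact isClosed_eq (continuous_id.matrix_mul continuous_id.matrix_transpose) continuous_const
  · rw [isBounded_iff_forall_norm_le]
    exact ⟨1, fun U hU => entrywise_sup_norm_bound_of_unitary hU⟩

/-- As π is open, it suffices that the orbit relation is closed. It is the projection along the
compact group O(n) of the closed set {(U, Θ, φ_U Θ)}. -/
theorem t2Space_orbitSpace (n m p : ℕ) : T2Space (OrbitSpace n m p) := by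
  rw [t2Space_iff_of_isOpenQuotientMap isOpenQuotientMap_proj]
  have h : {q : N n m p × N n m p | proj n m p q.1 = proj n m p q.2}
      = Prod.snd '' {r : Matrix.orthogonalGroup (Fin n) ℝ × (N n m p × N n m p) |
        r.2.2 = act r.1 r.2.1} := by
    ext q
    simp only [Set.mem_ofPred_eq, proj_eq_iff, Set.mem_image, Prod.exists]
    constructor
    · rintro ⟨U, hU⟩
      exact ⟨U, q.1, q.2, hU, rfl⟩
    · rintro ⟨U, Θ, Ξ, hU, rfl⟩
      exact ⟨U, hU⟩
  rw [h]
  refine isClosedMap_snd_of_compactSpace _ (isClosed_eq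
    (continuous_snd.comp continuous_snd) ?_)
  exact continuous_act continuous_fst (continuous_fst.comp continuous_snd)

theorem secondCountableTopology_orbitSpace (n m p : ℕ) :
    SecondCountableTopology (OrbitSpace n m p) := by
  have h1 : ProperSpace (Ambient n m p) := FiniteDimensional.proper_real _
  have h2 : SecondCountableTopology (Ambient n m p) := secondCountable_of_proper
  have h3 : SecondCountableTopology (N n m p) :=
    TopologicalSpace.Subtype.secondCountableTopology (N n m p : Set (Ambient n m p))
  exact TopologicalSpace.Quotient.secondCountableTopology isOpenMap_proj

/-! ### The smooth structure of the quotient -/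

section Chart

variable {Θ₀ : N n m p} (S : Slice Θ₀)

include S in
-- The chart evaluates f at an arbitrary representative of the orbit; invariance makes this choice
-- immaterial.
theorem Slice.out_mem {Θ : N n m p} (hΘ : (Θ : Ambient n m p) ∈ S.U) :
    (((proj n m p Θ).out : N n m p) : Ambient n m p) ∈ S.U ∧
      S.f ((proj n m p Θ).out : N n m p) = S.f Θ := by
  obtain ⟨V, hV⟩ := proj_eq_iff.mp (Quotient.out_eq (proj n m p Θ)).symm
  have h : (((proj n m p Θ).out : N n m p) : Ambient n m p) = rot m p V Θ := congrArg Subtype.val hV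
  rw [h]
  exact ⟨S.rot_mem V Θ hΘ, S.f_rot V Θ hΘ⟩

open Classical in
/-- The section of a slice, as a map to `N`. -/
def Slice.sect (h : EuclideanSpace ℝ (Fin (qdim n m p))) : N n m p :=
  -- The default Θ₀ is never taken on `S.B`, where the section lands in `S.U` ⊆ N.
  if hh : S.s h ∈ N n m p then ⟨S.s h, hh⟩ else Θ₀

theorem Slice.coe_sect {h : EuclideanSpace ℝ (Fin (qdim n m p))} (hh : h ∈ S.B) :
    (S.sect h : Ambient n m p) = S.s h := by
  rw [Slice.sect, dif_pos (S.subset _ (S.s_mem h hh))]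

theorem Slice.sect_mem {h : EuclideanSpace ℝ (Fin (qdim n m p))} (hh : h ∈ S.B) :
    (S.sect h : Ambient n m p) ∈ S.U := by
  rw [S.coe_sect hh]
  exact S.s_mem h hh

/-- The chart of the quotient defined by a slice. -/
def Slice.chart : OpenPartialHomeomorph (OrbitSpace n m p)
    (EuclideanSpace ℝ (Fin (qdim n m p))) where
  toFun q := S.f (q.out : N n m p)
  invFun h := proj n m p (S.sect h)
  source := proj n m p '' (Subtype.val ⁻¹' S.U)
  target := S.B
  map_source' := by
    rintro _ ⟨Θ, hΘ, rfl⟩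
    rw [(S.out_mem hΘ).2]
    exact S.f_mem _ hΘ
  map_target' := fun h hh => ⟨_, S.sect_mem hh, rfl⟩
  left_inv' := by
    rintro _ ⟨Θ, hΘ, rfl⟩
    rw [(S.out_mem hΘ).2]
    obtain ⟨V, hV⟩ := S.s_f Θ hΘ
    rw [eq_comm, proj_eq_iff]
    exact ⟨V, Subtype.ext ((S.coe_sect (S.f_mem _ hΘ)).trans hV)⟩
  right_inv' := by
    intro h hh
    rw [(S.out_mem (S.sect_mem hh)).2, S.coe_sect hh, S.f_s h hh]
  open_source := isOpenMap_proj _ (S.isOpen_U.preimage continuous_subtype_val)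
  open_target := S.isOpen_B
  continuousOn_toFun := by
    rintro _ ⟨Θ, hΘ, rfl⟩
    refine ContinuousAt.continuousWithinAt ?_
    have hU : IsOpen (Subtype.val ⁻¹' S.U : Set (N n m p)) := S.isOpen_U.preimage continuous_subtype_val
    have hc : ContinuousAt (fun Θ : N n m p => S.f Θ) Θ :=
      ContinuousAt.comp (g := S.f) (S.contDiffOn_f.continuousOn.continuousAt (S.isOpen_U.mem_nhds hΘ))
        continuous_subtype_val.continuousAt
    rw [← isOpenQuotientMap_proj.continuousAt_comp_iff]
    refine hc.congr ?_
    filter_upwards [hU.mem_nhds hΘ] with Ξ hΞ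
    exact (S.out_mem hΞ).2.symm
  continuousOn_invFun := by
    refine continuous_proj.comp_continuousOn ?_
    rw [Topology.IsInducing.subtypeVal.continuousOn_iff]
    exact S.contDiffOn_s.continuousOn.congr fun h hh => S.coe_sect hh

theorem Slice.chart_proj {Θ : N n m p} (hΘ : (Θ : Ambient n m p) ∈ S.U) :
    S.chart (proj n m p Θ) = S.f Θ := (S.out_mem hΘ).2

theorem Slice.mem_chart_source_iff (Θ : N n m p) :
    proj n m p Θ ∈ S.chart.source ↔ (Θ : Ambient n m p) ∈ S.U := by
  constructor
  · rintro ⟨Ξ, hΞ, h⟩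
    obtain ⟨V, rfl⟩ := proj_eq_iff.mp h
    exact S.rot_mem V _ hΞ
  · exact fun h => ⟨Θ, h, rfl⟩

end Chart

/-- A choice of slices. -/
def slice (Θ₀ : N n m p) : Slice Θ₀ := (exists_slice Θ₀).some

/-- The atlas of the quotient given by slices. -/
@[reducible]
def orbitChartedSpace (n m p : ℕ) :
    ChartedSpace (EuclideanSpace ℝ (Fin (qdim n m p))) (OrbitSpace n m p) where
  atlas := Set.range fun Θ₀ : N n m p => (slice Θ₀).chart
  chartAt q := (slice q.out).chart
  mem_chart_source q := by
    have h := ((slice q.out).mem_chart_source_iff q.out).mpr (slice q.out).mem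
    rwa [show proj n m p q.out = q from Quotient.out_eq q] at h
  chart_mem_atlas q := ⟨_, rfl⟩

/-- A change of charts is f₂ ∘ s₁: the section of one slice followed by the invariant coordinates of
the other. -/
theorem isManifold_orbitSpace (n m p : ℕ) :
    letI := orbitChartedSpace n m p
    IsManifold (𝓡 (qdim n m p)) ∞ (OrbitSpace n m p) := by
  let _ := orbitChartedSpace n m p
  refine isManifold_of_contDiffOn _ _ _ ?_
  rintro _ _ ⟨Θ₁, rfl⟩ ⟨Θ₂, rfl⟩
  set S₁ := slice Θ₁
  set S₂ := slice Θ₂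
  have key : ∀ h ∈ (S₁.chart.symm ≫ₕ S₂.chart).source, h ∈ S₁.B ∧ S₁.s h ∈ S₂.U ∧
      S₂.chart (S₁.chart.symm h) = S₂.f (S₁.s h) := by
    intro h hh
    have h1 : h ∈ S₁.B := hh.1
    have h2 : (S₁.sect h : Ambient n m p) ∈ S₂.U := (S₂.mem_chart_source_iff _).mp hh.2
    rw [← S₁.coe_sect h1]
    exact ⟨h1, h2, S₂.chart_proj h2⟩
  have hc : ContDiffOn ℝ ∞ (S₂.f ∘ S₁.s) (S₁.chart.symm ≫ₕ S₂.chart).source :=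
    S₂.contDiffOn_f.comp (S₁.contDiffOn_s.mono fun h hh => (key h hh).1)
      fun h hh => (key h hh).2.1
  refine (hc.congr fun h hh => (key h hh).2.2).mono ?_
  intro h hh
  exact hh.1

/-- A slice controls the derivative of f only at its centre, so at each Θ the chart of the slice
through Θ itself is used. There π reads as f. -/
theorem isSubmersion_proj (n m p : ℕ) :
    letI := orbitChartedSpace n m p
    Manifold.IsSubmersion 𝓘(ℝ, Ambient n m p) (𝓡 (qdim n m p)) ∞ (proj n m p) := by
  let _ := orbitChartedSpace n m p
  have := isManifold_orbitSpace n m p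
  refine ⟨SkewMat n, inferInstance, inferInstance, fun Θ => ?_⟩
  let S := slice Θ
  obtain ⟨e, he⟩ := exists_equiv_prod_of_surjective (K := SkewMat n) (fderiv ℝ S.f Θ)
    S.surjective_fderiv (by rw [finrank_euclideanSpace_fin]; exact finrank_ambient n m p)
  exact isSubmersionAtOfComplement_of_chart (N n m p) Θ continuous_proj.continuousAt S.chart
    (IsManifold.subset_maximalAtlas ⟨Θ, rfl⟩) ((S.mem_chart_source_iff Θ).mpr S.mem) S.isOpen_U S.mem
    S.contDiffOn_f (fun y hy => S.chart_proj hy) e he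

end

/-! ### The trace form as an invariant Riemannian metric on N. -/

section

variable {n m p : ℕ}

/-! ### The trace form -/

/-- The trace form at `Θ`, as a continuous bilinear form. -/
def metricForm (Θ : Ambient n m p) : Ambient n m p →L[ℝ] Ambient n m p →L[ℝ] ℝ :=
  (LinearMap.mk₂ ℝ (fun v w : Ambient n m p =>
      (Θ.A⁻¹ * v.A * Θ.A⁻¹ * w.A).trace + (v.Bᵀ * w.B).trace + (v.Cᵀ * w.C).trace)
    (fun v v' w => by
      simp only [Ambient.add_A, Ambient.add_B, Ambient.add_C, Matrix.mul_add, Matrix.add_mul,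
        Matrix.transpose_add, Matrix.trace_add]
      ring)
    (fun c v w => by
      simp only [Ambient.smul_A, Ambient.smul_B, Ambient.smul_C, Matrix.mul_smul, Matrix.smul_mul,
        Matrix.transpose_smul, Matrix.trace_smul, smul_eq_mul]
      ring)
    (fun v w w' => by
      simp only [Ambient.add_A, Ambient.add_B, Ambient.add_C, Matrix.mul_add, Matrix.trace_add]
      ring)
    (fun c v w => by
      simp only [Ambient.smul_A, Ambient.smul_B, Ambient.smul_C, Matrix.mul_smul,
        Matrix.trace_smul, smul_eq_mul]
      ring)).toContinuousBilinearMap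

theorem metricForm_apply (Θ : N n m p) (v w : Ambient n m p) :
    metricForm (Θ : Ambient n m p) v w = metric Θ v w := rfl

theorem metric_symm (Θ : N n m p) (v w : Ambient n m p) : metric Θ v w = metric Θ w v := by
  have hA : (Θ.1.A⁻¹ * v.A * Θ.1.A⁻¹ * w.A).trace = (Θ.1.A⁻¹ * w.A * Θ.1.A⁻¹ * v.A).trace := by
    rw [Matrix.mul_assoc (Θ.1.A⁻¹ * v.A), Matrix.trace_mul_comm, Matrix.mul_assoc _ _ v.A]
  have hB : (v.Bᵀ * w.B).trace = (w.Bᵀ * v.B).trace := by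
    rw [← Matrix.trace_transpose, Matrix.transpose_mul, Matrix.transpose_transpose]
  have hC : (v.Cᵀ * w.C).trace = (w.Cᵀ * v.C).trace := by
    rw [← Matrix.trace_transpose, Matrix.transpose_mul, Matrix.transpose_transpose]
  rw [metric, metric, hA, hB, hC]

theorem trace_transpose_mul_self_nonneg {a b : ℕ} (X : Matrix (Fin a) (Fin b) ℝ) :
    0 ≤ (Xᵀ * X).trace := by
  simp only [Matrix.trace, Matrix.diag_apply, Matrix.mul_apply, Matrix.transpose_apply]
  exact Finset.sum_nonneg fun i _ => Finset.sum_nonneg fun j _ => mul_self_nonneg _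

theorem trace_transpose_mul_self_eq_zero {a b : ℕ} {X : Matrix (Fin a) (Fin b) ℝ}
    (h : (Xᵀ * X).trace = 0) : X = 0 :=
  Matrix.trace_conjTranspose_mul_self_eq_zero_iff.mp
    (by rwa [Matrix.conjTranspose_eq_transpose_of_trivial])

open scoped MatrixOrder Matrix.Norms.L2Operator in
theorem exists_eq_transpose_mul_self {A : Matrix (Fin n) (Fin n) ℝ} (hA : A.PosDef) :
    ∃ R : Matrix (Fin n) (Fin n) ℝ, IsUnit R.det ∧ A = Rᵀ * R := by
  obtain ⟨R, hR⟩ := CStarAlgebra.nonneg_iff_eq_star_mul_self.mp hA.posSemidef.nonneg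
  rw [Matrix.star_eq_conjTranspose, Matrix.conjTranspose_eq_transpose_of_trivial] at hR
  refine ⟨R, isUnit_iff_ne_zero.mpr fun h => hA.det_pos.ne' ?_, hR⟩
  rw [hR, Matrix.det_mul, h, mul_zero]

/-- For `A` positive definite and `ξ` symmetric, `tr(A⁻¹ ξ A⁻¹ ξ)` is the squared Frobenius norm of
a matrix that vanishes only with `ξ`. -/
theorem exists_trace_eq {A ξ : Matrix (Fin n) (Fin n) ℝ} (hA : A.PosDef) (hξ : ξ.IsSymm) :
    ∃ Y : Matrix (Fin n) (Fin n) ℝ, (A⁻¹ * ξ * A⁻¹ * ξ).trace = (Yᵀ * Y).trace ∧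
      (Y = 0 → ξ = 0) := by
  obtain ⟨R, hRd, hAR⟩ := exists_eq_transpose_mul_self hA.inv
  -- With A⁻¹ = RᵀR, cyclicity of the trace moves one Rᵀ to the end and leaves tr(RξRᵀ · RξRᵀ), a
  -- square of a symmetric matrix.
  refine ⟨R * ξ * Rᵀ, ?_, fun h => ?_⟩
  · rw [hAR, Matrix.transpose_mul, Matrix.transpose_mul, Matrix.transpose_transpose, hξ.eq]
    calc (Rᵀ * R * ξ * (Rᵀ * R) * ξ).trace = (Rᵀ * (R * ξ * Rᵀ * R * ξ)).trace := by
          simp only [Matrix.mul_assoc]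
      _ = (R * ξ * Rᵀ * R * ξ * Rᵀ).trace := Matrix.trace_mul_comm _ _
      _ = _ := by simp only [Matrix.mul_assoc]
  · have hRt : IsUnit Rᵀ.det := by rwa [Matrix.det_transpose]
    calc ξ = R⁻¹ * (R * ξ * Rᵀ) * (Rᵀ)⁻¹ := by
          rw [Matrix.mul_assoc R, Matrix.nonsing_inv_mul_cancel_left _ _ hRd,
            Matrix.mul_nonsing_inv_cancel_right _ _ hRt]
      _ = 0 := by rw [h, Matrix.mul_zero, Matrix.zero_mul]

theorem metric_pos (Θ : N n m p) {v : Ambient n m p} (hv : v ≠ 0) : 0 < metric Θ v v := by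
  obtain ⟨Y, hY, hY0⟩ := exists_trace_eq Θ.2.1 v.isSymm
  have h1 := trace_transpose_mul_self_nonneg Y
  have h2 := trace_transpose_mul_self_nonneg v.B
  have h3 := trace_transpose_mul_self_nonneg v.C
  rw [metric, hY]
  refine lt_of_le_of_ne (by positivity) fun h => hv ?_
  refine Ambient.ext (hY0 (trace_transpose_mul_self_eq_zero ?_))
    (trace_transpose_mul_self_eq_zero ?_) (trace_transpose_mul_self_eq_zero ?_) <;> linarith

theorem contDiffOn_metricForm :
    ContDiffOn ℝ ∞ (metricForm (n := n) (m := m) (p := p)) (N n m p) := by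
  have hinv : ContDiffOn ℝ ∞ (fun Θ : Ambient n m p => Θ.A⁻¹) (N n m p) :=
    contDiffOn_matrix_inv contDiff_A.contDiffOn fun Θ hΘ => hΘ.1.det_pos.ne'
  refine contDiffOn_clm_apply.mpr fun v => contDiffOn_clm_apply.mpr fun w => ?_
  have h := contDiffOn_matrix_trace (contDiffOn_matrix_mul (contDiffOn_matrix_mul
    (contDiffOn_matrix_mul hinv (contDiffOn_const (c := v.A))) hinv) (contDiffOn_const (c := w.A)))
  exact (h.add contDiffOn_const).add contDiffOn_const

/-! ### Smoothness of metrics -/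

/-- A metric on the tangent bundle is smooth at `q₀` if it is the pull-back, by the derivative of a
chart, of a smooth family of bilinear forms on the model space. -/
theorem contMDiffAt_metric_of_chart {F Q : Type*} [NormedAddCommGroup F] [NormedSpace ℝ F]
    [TopologicalSpace Q] [ChartedSpace F Q] [IsManifold 𝓘(ℝ, F) ∞ Q]
    (g : ∀ q : Q, TangentSpace 𝓘(ℝ, F) q →L[ℝ] TangentSpace 𝓘(ℝ, F) q →L[ℝ] ℝ) (q₀ : Q)
    {G : Q → F →L[ℝ] F →L[ℝ] ℝ} (hG : ContMDiffAt 𝓘(ℝ, F) 𝓘(ℝ, F →L[ℝ] F →L[ℝ] ℝ) ∞ G q₀)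
    (h : ∀ᶠ q in 𝓝 q₀, ∀ v w : TangentSpace 𝓘(ℝ, F) q,
      G q (mfderiv 𝓘(ℝ, F) 𝓘(ℝ, F) (extChartAt 𝓘(ℝ, F) q₀) q v)
        (mfderiv 𝓘(ℝ, F) 𝓘(ℝ, F) (extChartAt 𝓘(ℝ, F) q₀) q w) = g q v w) :
    ContMDiffAt 𝓘(ℝ, F) (𝓘(ℝ, F).prod 𝓘(ℝ, F →L[ℝ] F →L[ℝ] ℝ)) ∞
      (fun q => Bundle.TotalSpace.mk' (F →L[ℝ] F →L[ℝ] ℝ)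
        (E := fun q : Q => TangentSpace 𝓘(ℝ, F) q →L[ℝ] TangentSpace 𝓘(ℝ, F) q →L[ℝ] ℝ) q (g q)) q₀ := by
  rw [Bundle.contMDiffAt_section]
  refine hG.congr_of_eventuallyEq ?_
  filter_upwards [h, chart_source_mem_nhds F q₀] with q hq hqs
  have hb : q ∈ (trivializationAt F (TangentSpace 𝓘(ℝ, F)) q₀).baseSet := hqs
  ext v w
  rw [hom_trivializationAt_apply, inCoordinates_apply_eq₂ hb hb (Set.mem_univ _)]
  -- In the trivialization at q₀ the derivative of the chart is the fiber coordinate, so it undoes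
  -- the inverse trivialization; the coordinate expression of the metric is therefore G.
  have key : ∀ u : F, mfderiv 𝓘(ℝ, F) 𝓘(ℝ, F) (extChartAt 𝓘(ℝ, F) q₀) q
      ((trivializationAt F (TangentSpace 𝓘(ℝ, F)) q₀).symm q u) = u := by
    intro u
    rw [← TangentBundle.continuousLinearMapAt_trivializationAt hqs]
    have := Bundle.Trivialization.continuousLinearMapAt_symmL (R := ℝ)
      (trivializationAt F (TangentSpace 𝓘(ℝ, F)) q₀) hb u
    rwa [Bundle.Trivialization.symmL_apply (R := ℝ) _ hb] at this
  have h1 := hq ((trivializationAt F (TangentSpace 𝓘(ℝ, F)) q₀).symm q v)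
    ((trivializationAt F (TangentSpace 𝓘(ℝ, F)) q₀).symm q w)
  rw [key, key] at h1
  simp
  exact h1.symm

/-- The trace form as a smooth Riemannian metric on `N`. -/
def metricN (n m p : ℕ) : Bundle.ContMDiffRiemannianMetric 𝓘(ℝ, Ambient n m p) ∞ (Ambient n m p)
    (fun Θ : N n m p => TangentSpace 𝓘(ℝ, Ambient n m p) Θ) where
  inner Θ := metricForm (Θ : Ambient n m p)
  symm Θ v w := metric_symm Θ v w
  pos Θ v hv := metric_pos Θ hv
  isVonNBounded Θ := isVonNBounded_of_pos (metricForm (Θ : Ambient n m p))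
    fun _ hv => metric_pos Θ hv
  contMDiff Θ₀ := by
    refine contMDiffAt_metric_of_chart (F := Ambient n m p) (Q := N n m p)
      (fun Θ : N n m p => metricForm (Θ : Ambient n m p)) Θ₀
      (G := fun Θ => metricForm (Θ : Ambient n m p)) ?_ (Filter.Eventually.of_forall ?_)
    · have h : ContMDiffAt 𝓘(ℝ, Ambient n m p) _ ∞
          (metricForm (n := n) (m := m) (p := p)) (Θ₀ : Ambient n m p) :=
        (contDiffOn_metricForm.contDiffAt ((N n m p).isOpen.mem_nhds Θ₀.2)).contMDiffAt
      exact h.comp Θ₀ (contMDiff_subtype_val (U := N n m p)).contMDiffAt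
    · intro Θ v w
      have h : mfderiv 𝓘(ℝ, Ambient n m p) 𝓘(ℝ, Ambient n m p)
          (extChartAt 𝓘(ℝ, Ambient n m p) Θ₀) Θ = ContinuousLinearMap.id ℝ (Ambient n m p) :=
        (mfderiv_coe_opens (N n m p) Θ).mfderiv
      rw [h]
      rfl

/-! ### The action is by isometric diffeomorphisms -/

theorem contMDiff_act (U : Matrix.orthogonalGroup (Fin n) ℝ) :
    ContMDiff 𝓘(ℝ, Ambient n m p) 𝓘(ℝ, Ambient n m p) ∞ (act (m := m) (p := p) U) := by
  intro Θ
  have h := ((contMDiffOn_opens_symm (N n m p) ⟨Θ⟩).contMDiffAt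
    ((N n m p).isOpen.mem_nhds (act U Θ).2)).comp Θ
    (((rotL m p U).contMDiff.contMDiffAt).comp Θ
      (contMDiff_subtype_val (U := N n m p)).contMDiffAt)
  refine h.congr_of_eventuallyEq (Filter.Eventually.of_forall fun Ξ => ?_)
  exact (((N n m p).openPartialHomeomorphSubtypeCoe ⟨Θ⟩).left_inv (x := act U Ξ) (by simp)).symm

/-- `φ_U` as a diffeomorphism. -/
def actDiffeomorph (m p : ℕ) (U : Matrix.orthogonalGroup (Fin n) ℝ) :
    N n m p ≃ₘ^∞⟮𝓘(ℝ, Ambient n m p), 𝓘(ℝ, Ambient n m p)⟯ N n m p where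
  toFun := act U
  invFun := act U⁻¹
  left_inv Θ := by rw [← act_mul, mul_inv_cancel, act_one]
  right_inv Θ := by rw [← act_mul, inv_mul_cancel, act_one]
  contMDiff_toFun := contMDiff_act U
  contMDiff_invFun := contMDiff_act U⁻¹

/-- φ_U is the restriction of a linear map, and the inclusion of N has derivative the identity. -/
theorem hasMFDerivAt_act (U : Matrix.orthogonalGroup (Fin n) ℝ) (Θ : N n m p) :
    HasMFDerivAt 𝓘(ℝ, Ambient n m p) 𝓘(ℝ, Ambient n m p) (act U) Θ (rotL m p U) := by
  have h1 := ((contMDiff_act U).mdifferentiableAt (x := Θ) (by simp)).hasMFDerivAt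
  have h2 := (mfderiv_coe_opens (N n m p) (act U Θ)).comp Θ h1
  have h3 : HasMFDerivAt 𝓘(ℝ, Ambient n m p) 𝓘(ℝ, Ambient n m p)
      (Subtype.val ∘ act (m := m) (p := p) U) Θ
      ((rotL m p U).comp (ContinuousLinearMap.id ℝ (Ambient n m p))) :=
    (rotL m p U).hasMFDerivAt.comp Θ (mfderiv_coe_opens (N n m p) Θ)
  have h4 : mfderiv 𝓘(ℝ, Ambient n m p) 𝓘(ℝ, Ambient n m p) (act U) Θ = rotL m p U := by
    have := hasMFDerivAt_unique h2 h3
    exact this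
  rwa [h4] at h1

/-- Since (UᵀAU)⁻¹ = UᵀA⁻¹U, inner factors UUᵀ cancel and cyclicity of the trace removes the outer
ones. -/
theorem metric_act_rot (U : Matrix.orthogonalGroup (Fin n) ℝ) (Θ : N n m p)
    (v w : Ambient n m p) : metric (act U Θ) (rot m p U v) (rot m p U w) = metric Θ v w := by
  have hU := orth_mul_transpose U
  have hU' := orth_transpose_mul U
  have hinv : ((act U Θ).1.A)⁻¹ = (U : Matrix (Fin n) (Fin n) ℝ)ᵀ * Θ.1.A⁻¹ * U := by
    change ((U : Matrix (Fin n) (Fin n) ℝ)ᵀ * Θ.1.A * U)⁻¹ = _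
    rw [Matrix.mul_inv_rev, Matrix.mul_inv_rev, Matrix.inv_eq_left_inv hU',
      Matrix.inv_eq_left_inv hU, Matrix.mul_assoc]
  have hcancel : ∀ {k : ℕ} (X : Matrix (Fin n) (Fin k) ℝ),
      (U : Matrix (Fin n) (Fin n) ℝ) * ((U : Matrix (Fin n) (Fin n) ℝ)ᵀ * X) = X := fun X => by
    rw [← Matrix.mul_assoc, hU, Matrix.one_mul]
  have hA : ((act U Θ).1.A⁻¹ * (rot m p U v).A * (act U Θ).1.A⁻¹ * (rot m p U w).A).trace
      = (Θ.1.A⁻¹ * v.A * Θ.1.A⁻¹ * w.A).trace := by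
    rw [hinv, rot_A, rot_A]
    simp only [Matrix.mul_assoc, hcancel]
    rw [Matrix.trace_mul_comm]
    simp only [Matrix.mul_assoc, hU, Matrix.mul_one]
  have hB : ((rot m p U v).Bᵀ * (rot m p U w).B).trace = (v.Bᵀ * w.B).trace := by
    rw [rot_B, rot_B, Matrix.transpose_mul, Matrix.transpose_transpose, Matrix.mul_assoc, hcancel]
  have hC : ((rot m p U v).Cᵀ * (rot m p U w).C).trace = (v.Cᵀ * w.C).trace := by
    rw [rot_C, rot_C, Matrix.transpose_mul, Matrix.trace_mul_comm]
    simp only [Matrix.mul_assoc, hcancel]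
    rw [Matrix.trace_mul_comm]
  rw [metric, metric, hA, hB, hC]

end

/-! ### Horizontal lifts and the derivative of the projection. -/

section

variable {n m p : ℕ}

/-! ### Horizontal lifts, as linear algebra -/

section Lift

variable {F : Type*} [NormedAddCommGroup F] [NormedSpace ℝ F]

/-- The map `η ↦ (D η, ⟨vert Θ ·, η⟩_Θ)`. -/
def liftMap (D : Ambient n m p →L[ℝ] F) (Θ : Ambient n m p) :
    Ambient n m p →L[ℝ] F × (SkewMat n →L[ℝ] ℝ) :=
  D.prod (((ContinuousLinearMap.compL ℝ (SkewMat n) (Ambient n m p) ℝ).flip (vert Θ)).comp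
    (metricForm Θ).flip)

/-- The horizontal lift determined by `D`, whose kernel is to be the vertical space. -/
def lift (D : Ambient n m p →L[ℝ] F) (Θ : Ambient n m p) : F →L[ℝ] Ambient n m p :=
  -- `inverse` is total, with value 0 off the isomorphisms. The lift is thus defined for all D and
  -- Θ, and its smoothness reduces to that of inversion.
  (liftMap D Θ).inverse.comp (ContinuousLinearMap.inl ℝ F (SkewMat n →L[ℝ] ℝ))

/-- The kernel of D contains the vertical space and has the same dimension, so they agree. A vector
in the kernel of `liftMap` is then vertical and orthogonal to all vertical vectors, hence 0 by
positivity. -/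
theorem exists_equiv_liftMap [FiniteDimensional ℝ F] (hF : Module.finrank ℝ F = qdim n m p)
    {D : Ambient n m p →L[ℝ] F} {Θ : N n m p} (hD : Function.Surjective D)
    (hDv : ∀ Ω, D (vert (Θ : Ambient n m p) Ω) = 0) :
    ∃ e : Ambient n m p ≃L[ℝ] F × (SkewMat n →L[ℝ] ℝ),
      (e : Ambient n m p →L[ℝ] F × (SkewMat n →L[ℝ] ℝ)) = liftMap D (Θ : Ambient n m p) := by
  have hdual : Module.finrank ℝ (SkewMat n →L[ℝ] ℝ) = Module.finrank ℝ (SkewMat n) := by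
    rw [← (LinearMap.toContinuousLinearMap (𝕜 := ℝ) (E := SkewMat n) (F' := ℝ)).finrank_eq]
    exact Subspace.dual_finrank_eq
  refine exists_continuousLinearEquiv_of_injective _ ?_ ?_
  · have hle : LinearMap.range (vert (Θ : Ambient n m p)).toLinearMap
        ≤ LinearMap.ker D.toLinearMap := by
      rintro _ ⟨Ω, rfl⟩
      exact hDv Ω
    have hker : LinearMap.range (vert (Θ : Ambient n m p)).toLinearMap
        = LinearMap.ker D.toLinearMap := by
      refine Submodule.eq_of_le_of_finrank_eq hle ?_
      have h1 := LinearMap.finrank_range_add_finrank_ker D.toLinearMap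
      rw [LinearMap.range_eq_top.mpr hD, finrank_top, hF, finrank_ambient] at h1
      rw [LinearMap.finrank_range_of_inj (vert_injective Θ.2.2.1)]
      omega
    refine (injective_iff_map_eq_zero _).mpr fun η hη => ?_
    have h1 : D η = 0 := congrArg Prod.fst hη
    have h2 : η ∈ LinearMap.range (vert (Θ : Ambient n m p)).toLinearMap := by
      rw [hker]
      exact h1
    obtain ⟨Ω, hΩ⟩ := h2
    have h3 : metricForm (Θ : Ambient n m p) (vert (Θ : Ambient n m p) Ω) η = 0 :=
      DFunLike.congr_fun (congrArg Prod.snd hη) Ω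
    by_contra hne
    have h4 := metric_pos Θ hne
    rw [← metricForm_apply] at h4
    nth_rewrite 1 [← hΩ] at h4
    exact h4.ne' h3
  · rw [finrank_ambient, Module.finrank_prod, hF, hdual]

variable [FiniteDimensional ℝ F] (hF : Module.finrank ℝ F = qdim n m p)
  {D : Ambient n m p →L[ℝ] F} {Θ : N n m p} (hD : Function.Surjective D)
  (hDv : ∀ Ω, D (vert (Θ : Ambient n m p) Ω) = 0)

include hF hD hDv

theorem liftMap_lift (ξ : F) : liftMap D (Θ : Ambient n m p) (lift D Θ ξ) = (ξ, 0) := by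
  obtain ⟨e, he⟩ := exists_equiv_liftMap hF hD hDv
  rw [lift, ← he, ContinuousLinearMap.inverse_equiv]
  exact e.apply_symm_apply _

theorem apply_lift (ξ : F) : D (lift D (Θ : Ambient n m p) ξ) = ξ :=
  congrArg Prod.fst (liftMap_lift hF hD hDv ξ)

theorem metricForm_vert_lift (Ω : SkewMat n) (ξ : F) :
    metricForm (Θ : Ambient n m p) (vert (Θ : Ambient n m p) Ω) (lift D Θ ξ) = 0 :=
  DFunLike.congr_fun (congrArg Prod.snd (liftMap_lift hF hD hDv ξ)) Ω

theorem eq_lift {η : Ambient n m p} {ξ : F} (h1 : D η = ξ)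
    (h2 : ∀ Ω, metricForm (Θ : Ambient n m p) (vert (Θ : Ambient n m p) Ω) η = 0) :
    η = lift D (Θ : Ambient n m p) ξ := by
  obtain ⟨e, he⟩ := exists_equiv_liftMap hF hD hDv
  apply e.injective
  change (e : Ambient n m p →L[ℝ] F × (SkewMat n →L[ℝ] ℝ)) η
    = (e : Ambient n m p →L[ℝ] F × (SkewMat n →L[ℝ] ℝ)) (lift D (Θ : Ambient n m p) ξ)
  rw [he, liftMap_lift hF hD hDv]
  exact Prod.ext h1 (ContinuousLinearMap.ext h2)

/-- `liftMap` depends smoothly on the point, and inversion is smooth at isomorphisms. Surjectivity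
and the kernel condition are needed only at Θ itself. -/
theorem contDiffAt_lift {D' : Ambient n m p → Ambient n m p →L[ℝ] F} (hD' : D' Θ = D)
    (h : ContDiffAt ℝ ∞ D' (Θ : Ambient n m p)) :
    ContDiffAt ℝ ∞ (fun Ξ => lift (D' Ξ) Ξ) (Θ : Ambient n m p) := by
  obtain ⟨e, he⟩ := exists_equiv_liftMap hF hD hDv
  have hM : ContDiffAt ℝ ∞ (metricForm (n := n) (m := m) (p := p)) (Θ : Ambient n m p) :=
    contDiffOn_metricForm.contDiffAt ((N n m p).isOpen.mem_nhds Θ.2)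
  have hV : ContDiffAt ℝ ∞ (vert (n := n) (m := m) (p := p)) (Θ : Ambient n m p) :=
    contDiff_vert.contDiffAt
  have hL : ContDiffAt ℝ ∞ (fun Ξ : Ambient n m p => liftMap (D' Ξ) Ξ) (Θ : Ambient n m p) := by
    have h1 := (((ContinuousLinearMap.compL ℝ (SkewMat n) (Ambient n m p) ℝ).flip.contDiff).comp_contDiffAt
      _ hV).clm_comp ((ContinuousLinearMap.flipₗᵢ ℝ (Ambient n m p) (Ambient n m p)
        ℝ).toContinuousLinearEquiv.contDiff.comp_contDiffAt _ hM)
    have h2 := ((contDiffAt_const (c := ContinuousLinearMap.inl ℝ F (SkewMat n →L[ℝ] ℝ))).clm_comp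
      h).add ((contDiffAt_const (c := ContinuousLinearMap.inr ℝ F (SkewMat n →L[ℝ] ℝ))).clm_comp h1)
    refine h2.congr_of_eventuallyEq (Filter.Eventually.of_forall fun Ξ => ?_)
    refine ContinuousLinearMap.ext fun η => Prod.ext ?_ ?_
    · exact (add_zero (D' Ξ η)).symm
    · exact (zero_add (liftMap (D' Ξ) Ξ η).2).symm
  have hI : ContDiffAt ℝ ∞ (fun Ξ : Ambient n m p => (liftMap (D' Ξ) Ξ).inverse)
      (Θ : Ambient n m p) := by
    have h1 : ContDiffAt ℝ ∞ ContinuousLinearMap.inverse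
        (liftMap (D' (Θ : Ambient n m p)) (Θ : Ambient n m p)) := by
      rw [hD', ← he]
      exact contDiffAt_map_inverse e
    exact ContDiffAt.comp (Θ : Ambient n m p) (f := fun Ξ => liftMap (D' Ξ) Ξ) h1 hL
  exact hI.clm_comp contDiffAt_const

end Lift

/-! ### The derivative of the projection -/

theorem hasMFDerivAt_curve {γ : ℝ → N n m p}
    (hγ : ContDiff ℝ ∞ fun t => (γ t : Ambient n m p)) (t : ℝ) :
    ∃ γ' : ℝ →L[ℝ] Ambient n m p, HasMFDerivAt 𝓘(ℝ, ℝ) 𝓘(ℝ, Ambient n m p) γ t γ' ∧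
      γ' 1 = deriv (fun t => (γ t : Ambient n m p)) t := by
  have h1 : ContMDiffAt 𝓘(ℝ, ℝ) 𝓘(ℝ, Ambient n m p) ∞ γ t := by
    have h := ((contMDiffOn_opens_symm (N n m p) ⟨γ t⟩).contMDiffAt
      ((N n m p).isOpen.mem_nhds (γ t).2)).comp t hγ.contMDiff.contMDiffAt
    refine h.congr_of_eventuallyEq (Filter.Eventually.of_forall fun s => ?_)
    exact (((N n m p).openPartialHomeomorphSubtypeCoe ⟨γ t⟩).left_inv (x := γ s) (by simp)).symm
  obtain ⟨γ', h2⟩ : ∃ γ' : ℝ →L[ℝ] Ambient n m p,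
      HasMFDerivAt 𝓘(ℝ, ℝ) 𝓘(ℝ, Ambient n m p) γ t γ' :=
    ⟨_, (h1.mdifferentiableAt (by simp)).hasMFDerivAt⟩
  have h3 : HasFDerivAt (fun t => (γ t : Ambient n m p)) γ' t :=
    ((mfderiv_coe_opens (N n m p) (γ t)).comp t h2).hasFDerivAt
  exact ⟨γ', h2, h3.hasDerivAt.deriv.symm⟩

theorem mem_horizontal_iff {Θ : N n m p} {η : Ambient n m p} :
    η ∈ horizontal Θ ↔ ∀ Ω, metricForm (Θ : Ambient n m p) (vert (Θ : Ambient n m p) Ω) η = 0 := by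
  simp only [horizontal, vertical_eq_range, Set.mem_ofPred_eq, Set.forall_mem_range,
    metricForm_apply]

/-- φ_U⁻¹ maps curves in the fiber to curves in the fiber, hence vertical vectors to vertical ones;
the isometry φ_U then preserves orthogonality to them. -/
theorem rot_mem_horizontal (U : Matrix.orthogonalGroup (Fin n) ℝ) {Θ : N n m p} {η : Ambient n m p}
    (hη : η ∈ horizontal Θ) : rot m p U η ∈ horizontal (act U Θ) := by
  rintro v ⟨γ, hγ0, hγ, hγs, hγd⟩
  have hdiff : HasDerivAt (fun t => (γ t : Ambient n m p)) v 0 := by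
    rw [← hγd]
    exact (hγs.differentiable (by simp) 0).hasDerivAt
  have hv : rot m p U⁻¹ v ∈ vertical Θ := by
    refine ⟨fun t => act U⁻¹ (γ t), ?_, fun t => ?_, ?_, ?_⟩
    · simp only [hγ0]
      rw [← act_mul, mul_inv_cancel, act_one]
    · rw [proj_act, hγ, proj_act]
    · exact (rotL m p U⁻¹).contDiff.comp hγs
    · exact ((rotL m p U⁻¹).hasFDerivAt.comp_hasDerivAt (0 : ℝ) hdiff).deriv
  have hUv : rot m p U (rot m p U⁻¹ v) = v := by
    have hU : ((U⁻¹ : Matrix.orthogonalGroup (Fin n) ℝ) : Matrix (Fin n) (Fin n) ℝ)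
        = (U : Matrix (Fin n) (Fin n) ℝ)ᵀ := Matrix.conjTranspose_eq_transpose_of_trivial _
    have hc : ∀ {k : ℕ} (X : Matrix (Fin n) (Fin k) ℝ),
        (U : Matrix (Fin n) (Fin n) ℝ)ᵀ * ((U : Matrix (Fin n) (Fin n) ℝ) * X) = X := fun X => by
      rw [← Matrix.mul_assoc, orth_transpose_mul, Matrix.one_mul]
    refine Ambient.ext ?_ ?_ ?_ <;>
      simp only [rot_A, rot_B, rot_C, hU, Matrix.transpose_transpose, Matrix.mul_assoc, hc,
        orth_transpose_mul, Matrix.mul_one]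
  rw [← hUv, metric_act_rot]
  exact hη _ hv

section Quotient

variable [ChartedSpace (EuclideanSpace ℝ (Fin (qdim n m p))) (OrbitSpace n m p)]

/-- The derivative `Dπ(Θ)`, in the model spaces of the tangent spaces. -/
def dproj (Θ : N n m p) : Ambient n m p →L[ℝ] EuclideanSpace ℝ (Fin (qdim n m p)) :=
  mfderiv 𝓘(ℝ, Ambient n m p) (𝓡 (qdim n m p)) (proj n m p) Θ

variable (hsub : Manifold.IsSubmersion 𝓘(ℝ, Ambient n m p) (𝓡 (qdim n m p)) ∞ (proj n m p))

include hsub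

theorem contMDiff_proj : ContMDiff 𝓘(ℝ, Ambient n m p) (𝓡 (qdim n m p)) ∞ (proj n m p) :=
  fun Θ => (hsub.isSubmersionAt Θ).contMDiffAt

theorem hasMFDerivAt_proj (Θ : N n m p) :
    HasMFDerivAt 𝓘(ℝ, Ambient n m p) (𝓡 (qdim n m p)) (proj n m p) Θ (dproj Θ) :=
  ((contMDiff_proj hsub).mdifferentiableAt (by simp)).hasMFDerivAt

theorem dproj_surjective (Θ : N n m p) : Function.Surjective (dproj Θ) :=
  surjective_mfderiv (hsub.isSubmersionAt Θ)

/-- A vertical vector is the velocity of a curve on which π is constant. -/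
theorem dproj_vert (Θ : N n m p) (Ω : SkewMat n) : dproj Θ (vert (Θ : Ambient n m p) Ω) = 0 := by
  have hmem : vert (Θ : Ambient n m p) Ω ∈ vertical Θ := by
    rw [vertical_eq_range]
    exact ⟨Ω, rfl⟩
  obtain ⟨γ, hγ0, hγ, hγs, hγd⟩ := hmem
  obtain ⟨γ', h1, h2⟩ := hasMFDerivAt_curve hγs 0
  rw [hγd] at h2
  have h3 : HasMFDerivAt 𝓘(ℝ, Ambient n m p) (𝓡 (qdim n m p)) (proj n m p) (γ 0) (dproj Θ) := by
    rw [hγ0]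
    exact hasMFDerivAt_proj hsub Θ
  have h4 := h3.comp (0 : ℝ) h1
  have h5 : proj n m p ∘ γ = fun _ => proj n m p Θ := funext hγ
  rw [h5] at h4
  have h6 := hasMFDerivAt_unique h4 (hasMFDerivAt_const _ _)
  have h7 := DFunLike.congr_fun h6 (1 : ℝ)
  rw [← h2]
  exact h7

/-- The bridge from equations in the tangent bundle to linear algebra in the model spaces; existence
and uniqueness of lifts are read off from it. -/
theorem isHorizontalLift_iff {Θ : N n m p} {q : OrbitSpace n m p} (hq : proj n m p Θ = q)
    (ξ : TangentSpace (𝓡 (qdim n m p)) q) (η : Ambient n m p) :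
    IsHorizontalLift ⟨q, ξ⟩ Θ η ↔ η = lift (dproj Θ) (Θ : Ambient n m p) ξ := by
  subst hq
  have hF : Module.finrank ℝ (EuclideanSpace ℝ (Fin (qdim n m p))) = qdim n m p :=
    finrank_euclideanSpace_fin
  constructor
  · rintro ⟨h1, h2⟩
    refine eq_lift hF (dproj_surjective hsub Θ) (dproj_vert hsub Θ) ?_
      (mem_horizontal_iff.mp h1)
    have h3 := (Bundle.TotalSpace.ext_iff.mp h2).2
    exact eq_of_heq h3
  · rintro rfl
    refine ⟨mem_horizontal_iff.mpr fun Ω =>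
      metricForm_vert_lift hF (dproj_surjective hsub Θ) (dproj_vert hsub Θ) Ω ξ, ?_⟩
    exact congrArg (Bundle.TotalSpace.mk (proj n m p Θ))
      (apply_lift hF (dproj_surjective hsub Θ) (dproj_vert hsub Θ) ξ)

theorem existsUnique_horizontalLift (ξ : TangentBundle (𝓡 (qdim n m p)) (OrbitSpace n m p))
    (Θ : N n m p) (hΘ : proj n m p Θ = ξ.proj) : ∃! η : Ambient n m p, IsHorizontalLift ξ Θ η := by
  obtain ⟨q, ξ⟩ := ξ
  exact ⟨_, (isHorizontalLift_iff hsub hΘ ξ _).mpr rfl,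
    fun η hη => (isHorizontalLift_iff hsub hΘ ξ η).mp hη⟩

/-- Differentiating π ∘ φ_U = π shows that the rotated vector has the same image under Dπ. -/
theorem isHorizontalLift_act {ξ : TangentBundle (𝓡 (qdim n m p)) (OrbitSpace n m p)} {Θ : N n m p}
    {η : Ambient n m p} (h : IsHorizontalLift ξ Θ η) (U : Matrix.orthogonalGroup (Fin n) ℝ) :
    IsHorizontalLift ξ (act U Θ) (rot m p U η) := by
  refine ⟨rot_mem_horizontal U h.1, ?_⟩
  rw [← h.2]
  have hcomp : proj n m p ∘ act U = proj n m p := funext fun Ξ => proj_act U Ξ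
  have h1 := (hasMFDerivAt_proj hsub (act U Θ)).comp Θ (hasMFDerivAt_act U Θ)
  rw [hcomp] at h1
  have h2 : (dproj (act U Θ)).comp (rotL m p U) = dproj Θ := by
    have := hasMFDerivAt_unique h1 (hasMFDerivAt_proj hsub Θ)
    exact this
  exact Bundle.TotalSpace.ext (proj_act U Θ) (heq_of_eq (DFunLike.congr_fun h2 η))

end Quotient

end

/-! ### The Riemannian metric induced on the quotient. -/

section

variable {n m p : ℕ} [ChartedSpace (EuclideanSpace ℝ (Fin (qdim n m p))) (OrbitSpace n m p)]

/-! ### The metric of the quotient -/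

omit [ChartedSpace (EuclideanSpace ℝ (Fin (qdim n m p))) (OrbitSpace n m p)] in
theorem contDiffAt_flip {X E F : Type*} [NormedAddCommGroup X] [NormedSpace ℝ X]
    [NormedAddCommGroup E] [NormedSpace ℝ E] [NormedAddCommGroup F] [NormedSpace ℝ F]
    {f : X → E →L[ℝ] F →L[ℝ] ℝ} {x : X} (hf : ContDiffAt ℝ ∞ f x) :
    ContDiffAt ℝ ∞ (fun y => (f y).flip) x := by
  have h := LinearIsometryEquiv.contDiff (𝕜 := ℝ) (n := ∞) (E := E →L[ℝ] F →L[ℝ] ℝ)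
    (F := F →L[ℝ] E →L[ℝ] ℝ) (ContinuousLinearMap.flipₗᵢ ℝ E F ℝ)
  exact h.comp_contDiffAt x hf

section Quotient

variable (hsub : Manifold.IsSubmersion 𝓘(ℝ, Ambient n m p) (𝓡 (qdim n m p)) ∞ (proj n m p))

theorem IsHorizontalLift.proj_eq {q : OrbitSpace n m p} {ξ : TangentSpace (𝓡 (qdim n m p)) q}
    {Θ : N n m p} {η : Ambient n m p} (h : IsHorizontalLift ⟨q, ξ⟩ Θ η) : proj n m p Θ = q :=
  congrArg Bundle.TotalSpace.proj h.2

include hsub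

/-- By uniqueness the lifts at φ_U(Θ₁) are the rotated lifts at Θ₁, and φ_U is an isometry. -/
theorem metric_horizontalLift_eq {q : OrbitSpace n m p} {ξ ζ : TangentSpace (𝓡 (qdim n m p)) q}
    {Θ₁ Θ₂ : N n m p} {ξ₁ ζ₁ ξ₂ ζ₂ : Ambient n m p}
    (h1 : IsHorizontalLift ⟨q, ξ⟩ Θ₁ ξ₁) (h2 : IsHorizontalLift ⟨q, ζ⟩ Θ₁ ζ₁)
    (h3 : IsHorizontalLift ⟨q, ξ⟩ Θ₂ ξ₂) (h4 : IsHorizontalLift ⟨q, ζ⟩ Θ₂ ζ₂) :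
    metric Θ₁ ξ₁ ζ₁ = metric Θ₂ ξ₂ ζ₂ := by
  obtain ⟨U, rfl⟩ := proj_eq_iff.mp (h1.proj_eq.trans h3.proj_eq.symm)
  have e1 := (existsUnique_horizontalLift hsub _ _ h3.proj_eq).unique h3
    (isHorizontalLift_act hsub h1 U)
  have e2 := (existsUnique_horizontalLift hsub _ _ h4.proj_eq).unique h4
    (isHorizontalLift_act hsub h2 U)
  rw [e1, e2, metric_act_rot]

omit hsub in
/-- The inner product on `T_q (N/O(n))` given by horizontal lifts. -/
def quotientForm (q : OrbitSpace n m p) :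
    EuclideanSpace ℝ (Fin (qdim n m p)) →L[ℝ] EuclideanSpace ℝ (Fin (qdim n m p)) →L[ℝ] ℝ :=
  (metricForm (q.out : Ambient n m p)).bilinearComp (lift (dproj q.out) (q.out : Ambient n m p))
    (lift (dproj q.out) (q.out : Ambient n m p))

theorem quotientForm_eq {q : OrbitSpace n m p} {ξ ζ : TangentSpace (𝓡 (qdim n m p)) q}
    {Θ : N n m p} {ξ' ζ' : Ambient n m p} (h1 : IsHorizontalLift ⟨q, ξ⟩ Θ ξ')
    (h2 : IsHorizontalLift ⟨q, ζ⟩ Θ ζ') : quotientForm q ξ ζ = metric Θ ξ' ζ' := by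
  have hq : proj n m p q.out = q := Quotient.out_eq q
  exact metric_horizontalLift_eq hsub ((isHorizontalLift_iff hsub hq ξ _).mpr rfl)
    ((isHorizontalLift_iff hsub hq ζ _).mpr rfl) h1 h2

omit hsub in
theorem quotientForm_symm (q : OrbitSpace n m p) (ξ ζ : EuclideanSpace ℝ (Fin (qdim n m p))) :
    quotientForm q ξ ζ = quotientForm q ζ ξ := metric_symm _ _ _

theorem quotientForm_pos (q : OrbitSpace n m p) (ξ : EuclideanSpace ℝ (Fin (qdim n m p)))
    (hξ : ξ ≠ 0) : 0 < quotientForm q ξ ξ := by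
  refine metric_pos _ fun h => hξ ?_
  exact (apply_lift finrank_euclideanSpace_fin (dproj_surjective hsub q.out)
    (dproj_vert hsub q.out) ξ).symm.trans ((congrArg (dproj q.out) h).trans (map_zero _))

variable [IsManifold (𝓡 (qdim n m p)) ∞ (OrbitSpace n m p)]

/-- In a chart of the quotient, `Dπ` is a smooth family of linear maps. -/
theorem exists_contDiffAt_dproj (Θ₀ : N n m p) :
    ∃ D' : Ambient n m p → Ambient n m p →L[ℝ] EuclideanSpace ℝ (Fin (qdim n m p)),
      ContDiffAt ℝ ∞ D' (Θ₀ : Ambient n m p) ∧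
      ∀ Θ : N n m p, proj n m p Θ ∈ (chartAt (EuclideanSpace ℝ (Fin (qdim n m p)))
        (proj n m p Θ₀)).source → ∃ e : EuclideanSpace ℝ (Fin (qdim n m p)) ≃L[ℝ]
          EuclideanSpace ℝ (Fin (qdim n m p)),
        (∀ ξ, e ξ = mfderiv (𝓡 (qdim n m p)) (𝓡 (qdim n m p))
          (extChartAt (𝓡 (qdim n m p)) (proj n m p Θ₀)) (proj n m p Θ) ξ) ∧
        ∀ η, D' Θ η = e (dproj Θ η) := by
  let c := (N n m p).openPartialHomeomorphSubtypeCoe ⟨Θ₀⟩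
  -- `dproj Θ` takes values in a tangent space that varies with Θ. After one fixed chart of the
  -- quotient, π becomes a map between vector spaces, whose derivative is smooth and differs from
  -- `dproj` by an isomorphism e.
  let f : Ambient n m p → EuclideanSpace ℝ (Fin (qdim n m p)) := fun Ξ =>
    extChartAt (𝓡 (qdim n m p)) (proj n m p Θ₀) (proj n m p (c.symm Ξ))
  have hc : ∀ Θ : N n m p, c.symm (Θ : Ambient n m p) = Θ := fun Θ =>
    c.left_inv (x := Θ) (by simp [c])
  have hf : ∀ Θ : N n m p, proj n m p Θ ∈ (chartAt (EuclideanSpace ℝ (Fin (qdim n m p)))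
      (proj n m p Θ₀)).source → ContDiffAt ℝ ∞ f (Θ : Ambient n m p) := by
    intro Θ hΘ
    refine ContMDiffAt.contDiffAt ?_
    have h1 : ContMDiffAt (𝓡 (qdim n m p)) (𝓡 (qdim n m p)) ∞
        (extChartAt (𝓡 (qdim n m p)) (proj n m p Θ₀))
        (proj n m p (c.symm (Θ : Ambient n m p))) := by
      rw [hc]
      exact contMDiffAt_extChartAt' hΘ
    exact h1.comp (Θ : Ambient n m p) ((contMDiff_proj hsub).contMDiffAt.comp
      (Θ : Ambient n m p) ((contMDiffOn_opens_symm (N n m p) ⟨Θ₀⟩).contMDiffAt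
        ((N n m p).isOpen.mem_nhds Θ.2)))
  refine ⟨fderiv ℝ f, (hf Θ₀ (mem_chart_source _ _)).fderiv_right (by simp), fun Θ hΘ => ?_⟩
  obtain ⟨e, he⟩ := isInvertible_mfderiv_extChartAt (I := 𝓡 (qdim n m p)) (x := proj n m p Θ₀)
    (y := proj n m p Θ) (by simpa using hΘ)
  refine ⟨e, fun ξ => DFunLike.congr_fun he ξ, fun η => ?_⟩
  have h1 : HasMFDerivAt (𝓡 (qdim n m p)) (𝓡 (qdim n m p))
      (extChartAt (𝓡 (qdim n m p)) (proj n m p Θ₀)) (proj n m p Θ) e := by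
    rw [he]
    exact (mdifferentiableAt_extChartAt hΘ).hasMFDerivAt
  have h2 := h1.comp Θ (hasMFDerivAt_proj hsub Θ)
  have h3 : HasMFDerivAt 𝓘(ℝ, Ambient n m p) (𝓡 (qdim n m p)) f (Θ : Ambient n m p)
      (fderiv ℝ f (Θ : Ambient n m p)) :=
    ((hf Θ hΘ).differentiableAt (by simp)).hasFDerivAt.hasMFDerivAt
  have h4 := h3.comp Θ (mfderiv_coe_opens (N n m p) Θ)
  have h5 : f ∘ (Subtype.val : N n m p → Ambient n m p)
      = extChartAt (𝓡 (qdim n m p)) (proj n m p Θ₀) ∘ proj n m p := by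
    funext Ξ
    simp only [f, Function.comp_apply, hc]
  rw [h5] at h4
  exact DFunLike.congr_fun (hasMFDerivAt_unique h4 h2) η

/-- The representative `q.out` need not depend continuously on q. As the form does not depend on the
representative, a smooth local section σ of π may replace it. -/
theorem contMDiff_quotientForm :
    ContMDiff (𝓡 (qdim n m p)) ((𝓡 (qdim n m p)).prod 𝓘(ℝ, EuclideanSpace ℝ (Fin (qdim n m p)) →L[ℝ]
        EuclideanSpace ℝ (Fin (qdim n m p)) →L[ℝ] ℝ)) ∞
      (fun q => Bundle.TotalSpace.mk' (EuclideanSpace ℝ (Fin (qdim n m p)) →L[ℝ]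
          EuclideanSpace ℝ (Fin (qdim n m p)) →L[ℝ] ℝ)
        (E := fun q : OrbitSpace n m p => TangentSpace (𝓡 (qdim n m p)) q →L[ℝ]
          TangentSpace (𝓡 (qdim n m p)) q →L[ℝ] ℝ) q (quotientForm q)) := by
  intro q₀
  obtain ⟨Θ₀, rfl⟩ := proj_surjective q₀
  have hF : Module.finrank ℝ (EuclideanSpace ℝ (Fin (qdim n m p))) = qdim n m p :=
    finrank_euclideanSpace_fin
  obtain ⟨D', hD', hD⟩ := exists_contDiffAt_dproj hsub Θ₀
  obtain ⟨σ, hσ₀, hσ, hσp⟩ := exists_local_section (hsub.isSubmersionAt Θ₀)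
  have hsurj : ∀ Θ : N n m p, proj n m p Θ ∈ (chartAt (EuclideanSpace ℝ (Fin (qdim n m p)))
      (proj n m p Θ₀)).source → Function.Surjective (D' Θ) := by
    intro Θ hΘ
    obtain ⟨e, -, he⟩ := hD Θ hΘ
    intro v
    obtain ⟨η, hη⟩ := dproj_surjective hsub Θ (e.symm v)
    exact ⟨η, by rw [he, hη, e.apply_symm_apply]⟩
  have hvert : ∀ Θ : N n m p, proj n m p Θ ∈ (chartAt (EuclideanSpace ℝ (Fin (qdim n m p)))
      (proj n m p Θ₀)).source → ∀ Ω, D' Θ (vert (Θ : Ambient n m p) Ω) = 0 := by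
    intro Θ hΘ Ω
    obtain ⟨e, -, he⟩ := hD Θ hΘ
    rw [he, dproj_vert hsub, map_zero]
  let G : Ambient n m p → EuclideanSpace ℝ (Fin (qdim n m p)) →L[ℝ]
      EuclideanSpace ℝ (Fin (qdim n m p)) →L[ℝ] ℝ := fun Ξ =>
    (metricForm Ξ).bilinearComp (lift (D' Ξ) Ξ) (lift (D' Ξ) Ξ)
  have hG : ContDiffAt ℝ ∞ G (Θ₀ : Ambient n m p) := by
    have hL := contDiffAt_lift hF (hsurj Θ₀ (mem_chart_source _ _))
      (hvert Θ₀ (mem_chart_source _ _)) rfl hD'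
    have hM : ContDiffAt ℝ ∞ (metricForm (n := n) (m := m) (p := p)) (Θ₀ : Ambient n m p) :=
      contDiffOn_metricForm.contDiffAt ((N n m p).isOpen.mem_nhds Θ₀.2)
    exact contDiffAt_flip ((contDiffAt_flip (hM.clm_comp hL)).clm_comp hL)
  refine contMDiffAt_metric_of_chart (F := EuclideanSpace ℝ (Fin (qdim n m p)))
    (Q := OrbitSpace n m p) quotientForm (proj n m p Θ₀) (G := fun q => G (σ q)) ?_ ?_
  · have h1 : ContMDiffAt 𝓘(ℝ, Ambient n m p) 𝓘(ℝ, EuclideanSpace ℝ (Fin (qdim n m p)) →L[ℝ]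
        EuclideanSpace ℝ (Fin (qdim n m p)) →L[ℝ] ℝ) ∞ G (σ (proj n m p Θ₀) : Ambient n m p) := by
      rw [hσ₀]
      exact hG.contMDiffAt
    exact ContMDiffAt.comp (g := G) (f := fun q => (σ q : Ambient n m p))
      (proj n m p Θ₀) h1 ((contMDiff_subtype_val (U := N n m p)).contMDiffAt.comp
      (proj n m p Θ₀) hσ)
  · filter_upwards [hσp, chart_source_mem_nhds (EuclideanSpace ℝ (Fin (qdim n m p)))
      (proj n m p Θ₀)] with q hq hqs v w
    have hs : proj n m p (σ q) ∈ (chartAt (EuclideanSpace ℝ (Fin (qdim n m p)))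
      (proj n m p Θ₀)).source := by rwa [hq]
    obtain ⟨e, he, hDe⟩ := hD (σ q) hs
    rw [hq] at he
    -- The lift is intrinsic: composing the derivative with e and applying e to the vector leaves it
    -- unchanged.
    have key : ∀ u, lift (D' (σ q)) (σ q : Ambient n m p) (e u)
        = lift (dproj (σ q)) (σ q : Ambient n m p) u := by
      intro u
      refine (eq_lift hF (hsurj _ hs) (hvert _ hs) ?_ fun Ω => ?_).symm
      · rw [hDe, apply_lift hF (dproj_surjective hsub _) (dproj_vert hsub _)]
      · exact metricForm_vert_lift hF (dproj_surjective hsub _) (dproj_vert hsub _) Ω u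
    have h1 : metric (σ q) (lift (dproj (σ q)) (σ q : Ambient n m p) v)
        (lift (dproj (σ q)) (σ q : Ambient n m p) w) = quotientForm q v w :=
      (quotientForm_eq hsub ((isHorizontalLift_iff hsub hq v _).mpr rfl)
        ((isHorizontalLift_iff hsub hq w _).mpr rfl)).symm
    exact (congrArg₂ (metric (σ q))
      ((congrArg (lift (D' (σ q)) (σ q : Ambient n m p)) (he v).symm).trans (key v))
      ((congrArg (lift (D' (σ q)) (σ q : Ambient n m p)) (he w).symm).trans (key w))).trans h1

/-- The Riemannian metric of the quotient. -/
def metricQuotient : Bundle.ContMDiffRiemannianMetric (𝓡 (qdim n m p)) ∞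
    (EuclideanSpace ℝ (Fin (qdim n m p)))
    (fun q : OrbitSpace n m p => TangentSpace (𝓡 (qdim n m p)) q) where
  inner q := quotientForm q
  symm q v w := quotientForm_symm q v w
  pos q v hv := quotientForm_pos hsub q v hv
  isVonNBounded q := isVonNBounded_of_pos (quotientForm q) (quotientForm_pos hsub q)
  contMDiff := contMDiff_quotientForm hsub

theorem existsUnique_metric : ∃! g : Bundle.ContMDiffRiemannianMetric (𝓡 (qdim n m p)) ∞
    (EuclideanSpace ℝ (Fin (qdim n m p)))
    (fun q : OrbitSpace n m p => TangentSpace (𝓡 (qdim n m p)) q),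
    ∀ (q : OrbitSpace n m p) (ξ ζ : TangentSpace (𝓡 (qdim n m p)) q) (Θ : N n m p)
      (ξ' ζ' : Ambient n m p), IsHorizontalLift ⟨q, ξ⟩ Θ ξ' → IsHorizontalLift ⟨q, ζ⟩ Θ ζ' →
      g.inner q ξ ζ = metric Θ ξ' ζ' := by
  refine ⟨metricQuotient hsub, fun q ξ ζ Θ ξ' ζ' h1 h2 => quotientForm_eq hsub h1 h2, fun g hg => ?_⟩
  -- Every tangent vector has a lift, so the condition determines all values of the inner product.
  have h : g.inner = (metricQuotient hsub).inner := by
    funext q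
    refine ContinuousLinearMap.ext fun ξ => ContinuousLinearMap.ext fun ζ => ?_
    have hq : proj n m p q.out = q := Quotient.out_eq q
    exact hg q ξ ζ q.out _ _ ((isHorizontalLift_iff hsub hq ξ _).mpr rfl)
      ((isHorizontalLift_iff hsub hq ζ _).mpr rfl)
  cases g
  simp only at h
  subst h
  rfl

end Quotient

end

end SymSys

end

theorem mainTheorem4 (n m p : ℕ) :
    -- the trace form is a smooth Riemannian metric on `N`
    (∃ gN : Bundle.ContMDiffRiemannianMetric 𝓘(ℝ, Ambient n m p) ∞ (Ambient n m p)
        (fun Θ : N n m p => TangentSpace 𝓘(ℝ, Ambient n m p) Θ),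
      ∀ (Θ : N n m p) (v w : TangentSpace 𝓘(ℝ, Ambient n m p) Θ),
        gN.inner Θ v w = metric Θ v w) ∧
    -- every `φ_U` is a diffeomorphism of `N` and an isometry
    (∀ U : Matrix.orthogonalGroup (Fin n) ℝ,
      (∃ Φ : N n m p ≃ₘ^∞⟮𝓘(ℝ, Ambient n m p), 𝓘(ℝ, Ambient n m p)⟯ N n m p, ⇑Φ = act U) ∧
      ∀ (Θ : N n m p) (v w : TangentSpace 𝓘(ℝ, Ambient n m p) Θ),
        metric (act U Θ)
          (mfderiv 𝓘(ℝ, Ambient n m p) 𝓘(ℝ, Ambient n m p) (act U) Θ v)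
          (mfderiv 𝓘(ℝ, Ambient n m p) 𝓘(ℝ, Ambient n m p) (act U) Θ w) = metric Θ v w) ∧
    -- `N/O(n)`, with the quotient topology, is a quotient manifold of `N`
    (T2Space (OrbitSpace n m p) ∧ SecondCountableTopology (OrbitSpace n m p) ∧
      ∃ _ : ChartedSpace (EuclideanSpace ℝ (Fin (qdim n m p))) (OrbitSpace n m p),
        IsManifold (𝓡 (qdim n m p)) ∞ (OrbitSpace n m p) ∧
        Manifold.IsSubmersion 𝓘(ℝ, Ambient n m p) (𝓡 (qdim n m p)) ∞ (proj n m p)) ∧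
    -- for the smooth structure of the quotient manifold:
    (∀ [ChartedSpace (EuclideanSpace ℝ (Fin (qdim n m p))) (OrbitSpace n m p)]
        [IsManifold (𝓡 (qdim n m p)) ∞ (OrbitSpace n m p)],
      Manifold.IsSubmersion 𝓘(ℝ, Ambient n m p) (𝓡 (qdim n m p)) ∞ (proj n m p) →
      -- horizontal lifts exist and are unique,
      (∀ (ξ : TangentBundle (𝓡 (qdim n m p)) (OrbitSpace n m p)) (Θ : N n m p),
        proj n m p Θ = ξ.proj → ∃! η : Ambient n m p, IsHorizontalLift ξ Θ η) ∧
      -- their inner product does not depend on the representative in the fiber,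
      (∀ (q : OrbitSpace n m p) (ξ ζ : TangentSpace (𝓡 (qdim n m p)) q) (Θ₁ Θ₂ : N n m p)
        (ξ₁ ζ₁ ξ₂ ζ₂ : Ambient n m p),
        IsHorizontalLift ⟨q, ξ⟩ Θ₁ ξ₁ → IsHorizontalLift ⟨q, ζ⟩ Θ₁ ζ₁ →
        IsHorizontalLift ⟨q, ξ⟩ Θ₂ ξ₂ → IsHorizontalLift ⟨q, ζ⟩ Θ₂ ζ₂ →
        metric Θ₁ ξ₁ ζ₁ = metric Θ₂ ξ₂ ζ₂) ∧
      -- and it defines a smooth Riemannian metric on `N/O(n)`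
      ∃! g : Bundle.ContMDiffRiemannianMetric (𝓡 (qdim n m p)) ∞
          (EuclideanSpace ℝ (Fin (qdim n m p)))
          (fun q : OrbitSpace n m p => TangentSpace (𝓡 (qdim n m p)) q),
        ∀ (q : OrbitSpace n m p) (ξ ζ : TangentSpace (𝓡 (qdim n m p)) q) (Θ : N n m p)
          (ξ' ζ' : Ambient n m p),
          IsHorizontalLift ⟨q, ξ⟩ Θ ξ' → IsHorizontalLift ⟨q, ζ⟩ Θ ζ' →
          g.inner q ξ ζ = metric Θ ξ' ζ') := by
  refine ⟨⟨metricN n m p, fun Θ v w => rfl⟩, fun U => ⟨⟨actDiffeomorph m p U, rfl⟩, ?_⟩,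
    ⟨t2Space_orbitSpace n m p, secondCountableTopology_orbitSpace n m p,
      orbitChartedSpace n m p, isManifold_orbitSpace n m p, isSubmersion_proj n m p⟩, ?_⟩
  · intro Θ v w
    rw [(hasMFDerivAt_act U Θ).mfderiv]
    exact metric_act_rot U Θ v w
  · intro _ _ hsub
    exact ⟨fun ξ Θ hΘ => existsUnique_horizontalLift hsub ξ Θ hΘ,
      fun q ξ ζ Θ₁ Θ₂ ξ₁ ζ₁ ξ₂ ζ₂ h1 h2 h3 h4 => metric_horizontalLift_eq hsub h1 h2 h3 h4,
      existsUnique_metric hsub⟩
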